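/- **Setting.** Let $A,B$ be finite groups and let $\{\Gamma_s\}_{s\ge 0}$ be a sequence of finite groups, where $\Gamma_s$ is generated by $A(s)\cup B(s)$ and $A(s),B(s)\le\Gamma_s$ are the images of $A,B$ under given injective homomorphisms $a\mapsto a(s)$, $b\mapsto b(s)$. Let $|\cdot|_{\Gamma_s}$ be the word length with respect to $A(s)\cup B(s)$ and $l_s=\mathrm{diam}(\Gamma_s)$. Let $\{k_s\}_{s\ge0}$ be non-negative integers. Let $\Delta_s=\Gamma_s\wr\mathbb Z$ (finitely supported lamp configurations $\mathbb Z\to\Gamma_s$ together with a position in $\mathbb Z$), with generators $\tau(s)=(e,+1)$, $\alpha_a(s)=(a(s)\delta_0,0)$ for $a\in A$, and $\beta_b(s)=(b(s)\delta_{k_s},0)$ for $b\in B$, and let $|\cdot|_{\Delta_s}$ be the corresponding word length. Let $\Delta\le\prod_{s\ge0}\Delta_s$ be the diagonal product, i.e. the subgroup generated by the elements $\tau=(\tau(s))_s$, $\alpha_a=(\alpha_a(s))_s$, $\beta_b=(\beta_b(s))_s$. Let $W_n$ be the random walk on $\Delta$ started at the identity with independent increments (multiplied on the right) of law $$q=(U_\alpha*U_\beta)*\mu*(U_\alpha*U_\beta),$$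 where $U_\alpha,U_\beta$ are uniform on $\{\alpha_a\}_{a\in A}$, $\{\beta_b\}_{b\in B}$ and $\mu$ is uniform on $\{\tau,\tau^{-1}\}$. Write $|W_n|_{\Delta_s}$ for the word length of the $\Delta_s$-coordinate of $W_n$, and let $S_n$ be the projection of $W_n$ to $\mathbb Z$ (a simple random walk). For integers $k\ge 0$, $n\ge 0$ and $x\in\mathbb Z$ let $T(k,x,n)$ be the number of $k$-excursions of $S$ starting at $x$ that are completed until time $n$, i.e. the number of times $j$ with $S_j=x$ such that $S$ returns to $x$ after time $j$, its first return time $r>j$ satisfies $r\le n$, and $S_i=x-k$ for some $j\le i<r$. (So $T(0,x,n)$ is the number of returns to $x$ until time $n$.) Let $\eta_s=U_{A(s)}*U_{B(s)}*U_{A(s)}$, where $U_{A(s)},U_{B(s)}$ are the uniform distributions on $A(s),B(s)$. The sequence $\{\Gamma_s\}$ satisfies the $(\sigma,T_s)$-linear speed assumption if $\mathbb E|X^{(s)}_t|_{\Gamma_s}\ge\sigma t$ for all $s\geq 0$ and all integers $0\le t\le T_s$, where $X^{(s)}_t$ has law $\eta_s^{*t}$. **Proposition.** There is a universal constant $d_2>0$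 such that the following holds for all data as above. Suppose $\{\Gamma_s\}$ satisfies the $(\sigma,c_0l_s)$-linear speed assumption for some constants $\sigma>0$ and $0<c_0<1$, and suppose there is $m_0>1$ such that $$k_{s+1}>2k_s\quad\text{and}\quad l_{s+1}\ge m_0l_s\qquad\text{for all }s\ge 0.$$ Then, almost surely, for all large enough $n$ and for all $s\ge 0$ such that $k_s\le\frac{d_2\sqrt n}{\sqrt{\log\log n}}$, $$|W_n|_{\Delta_s}\ \ge\ \frac{\sigma c_0}{16}\sum_{x\in\mathbb Z}\min\{T(k_s,x,n),\,c_0l_s\}.$$ -/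

import Mathlib

open MeasureTheory ProbabilityTheory Filter

/-! ### Word length, diameter, convolution powers -/

/-- Word length of `g` with respect to `S ∪ S⁻¹`: the least length of a word in the elements of `S`
and their inverses that represents `g`. (It is only used for `g` in the subgroup generated
by `S`.) -/
noncomputable def wordLength {G : Type*} [Group G] (S : Set G) (g : G) : ℕ :=
  sInf {n | ∃ w : List G, w.length = n ∧ (∀ x ∈ w, x ∈ S ∨ x⁻¹ ∈ S) ∧ w.prod = g}

/-- Diameter of a finite group in the word metric of `S`. -/
noncomputable def groupDiam {G : Type*} [Group G] [Fintype G] (S : Set G) : ℕ :=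
  Finset.univ.sup fun g : G => wordLength S g

/-- Convolution of two probability distributions on a group: the law of `x * y` for independent
`x ∼ p` and `y ∼ q`. -/
noncomputable def convolve {G : Type*} [Group G] (p q : PMF G) : PMF G :=
  p.bind fun x => q.map fun y => x * y

/-- The convolution power `p^{*t}`. -/
noncomputable def convolvePow {G : Type*} [Group G] (p : PMF G) : ℕ → PMF G
  | 0 => PMF.pure 1
  | t + 1 => convolve (convolvePow p t) p

/-! ### Lamp groups -/

/-- The uniform distribution on the image of a finite group under an (injective) map. -/
noncomputable def uniformImage {A G : Type*} [Group A] [Fintype A] (f : A → G) : PMF G :=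
  (PMF.uniformOfFintype A).map f

/-- The marking `A(s) ∪ B(s)` of a lamp group, where `A(s)`, `B(s)` are the images of `a`, `b`. -/
def lampGens {A B G : Type*} [Group A] [Group B] [Group G] (a : A →* G) (b : B →* G) : Set G :=
  Set.range a ∪ Set.range b

/-- The measure `η = U_A * U_B * U_A` on a lamp group. -/
noncomputable def lampStep {A B G : Type*} [Group A] [Fintype A] [Group B] [Fintype B] [Group G]
    (a : A →* G) (b : B →* G) : PMF G :=
  convolve (convolve (uniformImage a) (uniformImage b)) (uniformImage a)

/-- The speed `L_η(t)`: expected word length of an element with law `η^{*t}`. -/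
noncomputable def lampSpeed {A B G : Type*} [Group A] [Fintype A] [Group B] [Fintype B]
    [Group G] [Fintype G] (a : A →* G) (b : B →* G) (t : ℕ) : ℝ :=
  ∑ g : G, (convolvePow (lampStep a b) t g).toReal * (wordLength (lampGens a b) g : ℝ)

/-- The `(σ, T_s)`-linear speed assumption for a sequence of marked finite groups. -/
def LinearSpeed {A B : Type*} [Group A] [Fintype A] [Group B] [Fintype B] {Γ : ℕ → Type*}
    [∀ s, Group (Γ s)] [∀ s, Fintype (Γ s)] (a : ∀ s, A →* Γ s) (b : ∀ s, B →* Γ s)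
    (σ : ℝ) (T : ℕ → ℝ) : Prop :=
  ∀ s t : ℕ, (t : ℝ) ≤ T s → σ * t ≤ lampSpeed (a s) (b s) t

/-! ### The lamplighter group `Γ ≀ ℤ` -/

/-- Elements `(f, z)` of the restricted wreath product `Γ ≀ ℤ`: a finitely supported lamp
configuration `f : ℤ → Γ` and a cursor position `z`. -/
@[ext]
structure Lamplighter (Γ : Type*) [Group Γ] where
  lamp : ℤ → Γ
  pos : ℤ
  finite_support : (Function.mulSupport lamp).Finite

namespace Lamplighter

variable {Γ : Type*} [Group Γ]

/-- `(f, z) (f', z') = (x ↦ f x * f' (x - z), z + z')`. -/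
instance : Mul (Lamplighter Γ) where
  mul g h :=
    { lamp := fun x => g.lamp x * h.lamp (x - g.pos)
      pos := g.pos + h.pos
      finite_support := by
        refine (g.finite_support.union
          (h.finite_support.preimage (sub_left_injective (b := g.pos)).injOn)).subset ?_
        intro x hx
        by_contra hn
        simp only [Set.mem_union, Set.mem_preimage, Function.mem_mulSupport, not_or,
          not_not] at hn
        exact hx (by simp [hn.1, hn.2]) }

instance : One (Lamplighter Γ) where
  one := { lamp := fun _ => 1, pos := 0, finite_support := by simp [Function.mulSupport] }

instance : Inv (Lamplighter Γ) where
  inv g :=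
    { lamp := fun x => (g.lamp (x + g.pos))⁻¹
      pos := -g.pos
      finite_support := by
        refine (g.finite_support.preimage (add_left_injective g.pos).injOn).subset ?_
        intro x hx
        simpa [Function.mem_mulSupport] using hx }

theorem mul_lamp (g h : Lamplighter Γ) (x : ℤ) :
    (g * h).lamp x = g.lamp x * h.lamp (x - g.pos) := rfl

theorem mul_pos' (g h : Lamplighter Γ) : (g * h).pos = g.pos + h.pos := rfl

theorem one_lamp (x : ℤ) : (1 : Lamplighter Γ).lamp x = 1 := rfl

theorem one_pos : (1 : Lamplighter Γ).pos = 0 := rfl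

theorem inv_lamp (g : Lamplighter Γ) (x : ℤ) : (g⁻¹).lamp x = (g.lamp (x + g.pos))⁻¹ := rfl

theorem inv_pos (g : Lamplighter Γ) : (g⁻¹).pos = -g.pos := rfl

instance : Group (Lamplighter Γ) :=
  Group.ofLeftAxioms
    (fun f g h => by
      ext
      · simp [mul_lamp, mul_pos', mul_assoc, sub_sub]
      · simp [mul_pos', add_assoc])
    (fun g => by
      ext
      · simp [mul_lamp, one_lamp, one_pos]
      · simp [mul_pos', one_pos])
    (fun g => by
      ext
      · simp [mul_lamp, inv_lamp, inv_pos, one_lamp]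
      · simp [mul_pos', inv_pos, one_pos])

/-- The element `(γ δ_y, 0)`. -/
noncomputable def single (y : ℤ) (γ : Γ) : Lamplighter Γ where
  lamp := Pi.mulSingle y γ
  pos := 0
  finite_support := (Set.finite_singleton y).subset Pi.mulSupport_mulSingle_subset

/-- The element `(e, +1)`. -/
def shift : Lamplighter Γ where
  lamp := fun _ => 1
  pos := 1
  finite_support := by simp [Function.mulSupport]

end Lamplighter

/-! ### The diagonal product -/

/-- The subgroup of `∏ i, G i` generated by the diagonal elements `(x i j)_i`, `j : X`. -/
def diagonalProduct {ι X : Type*} {G : ι → Type*} [∀ i, Group (G i)] (x : ∀ i, X → G i) :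
    Subgroup (∀ i, G i) :=
  Subgroup.closure (Set.range fun (j : X) (i : ι) => x i j)

/-- The diagonal generator indexed by `j`. -/
def diagonalGen {ι X : Type*} {G : ι → Type*} [∀ i, Group (G i)] (x : ∀ i, X → G i) (j : X) :
    diagonalProduct x :=
  ⟨fun i => x i j, Subgroup.subset_closure ⟨j, rfl⟩⟩

/-- Labels of the generators: `τ`, `α_a` (`a ∈ A`) and `β_b` (`b ∈ B`). -/
inductive Letter (A B : Type*) where
  | tau : Letter A B
  | alpha : A → Letter A B
  | beta : B → Letter A B

/-- The generators `τ = (e, +1)`, `α_a = (a δ_0, 0)`, `β_b = (b δ_k, 0)` of `Γ ≀ ℤ`. -/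
noncomputable def layerGen {A B G : Type*} [Group A] [Group B] [Group G] (a : A →* G)
    (b : B →* G) (k : ℕ) : Letter A B → Lamplighter G
  | .tau => Lamplighter.shift
  | .alpha i => Lamplighter.single 0 (a i)
  | .beta i => Lamplighter.single k (b i)

/-- Word length `|g|_{Δ_s}` in one layer `Γ ≀ ℤ`. -/
noncomputable def layerLength {A B G : Type*} [Group A] [Group B] [Group G] (a : A →* G)
    (b : B →* G) (k : ℕ) (g : Lamplighter G) : ℕ :=
  wordLength (Set.range (layerGen a b k)) g

/-- The diagonal product `Δ` of the layers `Δ_s = Γ_s ≀ ℤ`. -/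
noncomputable abbrev Delta {A B : Type*} [Group A] [Group B] {Γ : ℕ → Type*} [∀ s, Group (Γ s)]
    (a : ∀ s, A →* Γ s) (b : ∀ s, B →* Γ s) (k : ℕ → ℕ) : Subgroup (∀ s, Lamplighter (Γ s)) :=
  diagonalProduct fun s => layerGen (a s) (b s) (k s)

/-- The diagonal generators of `Δ`. -/
noncomputable def deltaGen {A B : Type*} [Group A] [Group B] {Γ : ℕ → Type*} [∀ s, Group (Γ s)]
    (a : ∀ s, A →* Γ s) (b : ∀ s, B →* Γ s) (k : ℕ → ℕ) (j : Letter A B) : Delta a b k :=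
  diagonalGen (fun s => layerGen (a s) (b s) (k s)) j

/-- The "switch-walk-switch" distribution `q = (U_α * U_β) * μ * (U_α * U_β)` on `Δ`, where `μ` is
uniform on `{τ, τ⁻¹}`. -/
noncomputable def switchWalkSwitch {A B : Type*} [Group A] [Fintype A] [Group B] [Fintype B]
    {Γ : ℕ → Type*} [∀ s, Group (Γ s)] (a : ∀ s, A →* Γ s) (b : ∀ s, B →* Γ s) (k : ℕ → ℕ) :
    PMF (Delta a b k) :=
  let switch : PMF (Delta a b k) :=
    convolve (uniformImage fun i => deltaGen a b k (.alpha i))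
      (uniformImage fun i => deltaGen a b k (.beta i))
  let walk : PMF (Delta a b k) :=
    (PMF.uniformOfFintype Bool).map fun e =>
      if e then deltaGen a b k .tau else (deltaGen a b k .tau)⁻¹
  convolve (convolve switch walk) switch

/-! ### Random walks and excursions -/

/-- `W` is a (right) random walk on the countable group `G`, started at the identity: its
increments `W_n⁻¹ W_{n+1}` are independent with law `q`. The group carries the discrete
`σ`-algebra. -/
def IsRandomWalk {G : Type*} [Group G] (q : PMF G) {Ω : Type*} [MeasurableSpace Ω]
    (P : Measure Ω) (W : ℕ → Ω → G) : Prop :=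
  letI : MeasurableSpace G := ⊤
  (∀ ω, W 0 ω = 1) ∧
    (∀ n, HasLaw (fun ω => (W n ω)⁻¹ * W (n + 1) ω) q.toMeasure P) ∧
    iIndepFun (fun n ω => (W n ω)⁻¹ * W (n + 1) ω) P

/-- The projection of an element of `Δ` to `ℤ`: the cursor position, which is the same in all
layers. -/
def cursor {A B : Type*} [Group A] [Group B] {Γ : ℕ → Type*} [∀ s, Group (Γ s)]
    {a : ∀ s, A →* Γ s} {b : ∀ s, B →* Γ s} {k : ℕ → ℕ} (g : Delta a b k) : ℤ :=
  (g.1 0).pos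

/-- `T(k, x, n)`: the number of `k`-excursions of the path `S` starting at `x` that are completed
until time `n`. A `k`-excursion starts at a time `j` with `S j = x` if the path visits `x - k`
before its next visit `r > j` to `x`; it is completed at time `r`. (For `k = 0` the
visit at time `j` itself counts, so `T(0, x, n)` is the number of returns to `x` until time `n`.) -/
noncomputable def excursionCount (S : ℕ → ℤ) (k : ℕ) (x : ℤ) (n : ℕ) : ℕ :=
  Set.ncard {j : ℕ | S j = x ∧ ∃ r : ℕ, j < r ∧ r ≤ n ∧ S r = x ∧
    (∀ i, j < i → i < r → S i ≠ x) ∧ ∃ i, j ≤ i ∧ i < r ∧ S i = x - k}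

/-! Fix the path of the cursor. In a layer with parameter `k`, the lamp at `x` is then a product of
independent uniform letters: an `A`-letter for each switch made with the cursor at `x`, a `B`-letter
for each switch made at `x - k`. Equal neighbouring types merge, because the uniform distribution on
a group is idempotent (`letterAvg_letterAvg`). If `c ≥ 1` alternations `A … B … A` remain, the lamp
is distributed as `c` steps of `η`, up to one more `B`-letter at either end (`patternAvg_normal`). A
`k`-excursion from `x` forces such an alternation, so `c` is at least the number of completed
excursions (`excursionCount_aux`). By linear speed the expected length of the lamp is at least `σ /
12 * min c T` (`le_patternAvg_wordLength`), and the sum of the lamp lengths bounds the word length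
in the layer from below (`sum_wordLength_lamp_le`).

Given the path, the lamps at different sites are independent (`lampAvg_prod`). If the length at
every site with an alternation is at most `D`, a Chernoff bound shows that the total length falls
below `σ / 16 * ∑ min c T` with probability at most `exp (-(σ / (768 * D)) * ∑ min c T)`
(`wordProb_sum_wordLength_lt_le`). It remains to see that the sum exceeds `n ^ (1 / 8) * D`
(`GoodPath`); the failure probability is then summable even after a union over the layers `s ≤ n`.

Good paths come from two estimates on the simple random walk. No site has more than order `√n log n
/ k` alternations, since each further one costs a distance `2k` (`wordProb_siteCount_le`). The total
number of alternations is of order at least `n / k`: a block of `32 k²` steps creates `k + 1` of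
them with a fixed positive probability (`le_wordProb_down_up`), and blocks are independent
(`wordProb_totalCount_le`). The second estimate fails with probability about `exp (-const * n /
k²)`. It is needed only at dyadic times and for about `log n` layers, so a failure probability of
`(log n)⁻³` suffices; this is where the threshold `k ≤ d₂ √n / √(log log n)` comes from. Both bounds
together imply `GoodPath` (`goodPath_of_totalCount`); a layer with `k = 0` can only be the first one
and is compared with the next (`goodPath_zero_of_totalCount`).

The growth of the diameters enters only through `2 ≤ |A|` and `σ ≤ 3`. -/

/-! ### Averages over words of a given length -/

/-- The average of `F` over all words of length `n` in a finite alphabet. -/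
noncomputable def wordAvg {α : Type*} [Fintype α] : ℕ → (List α → ℝ) → ℝ
  | 0, F => F []
  | n + 1, F => (∑ a : α, wordAvg n fun l => F (a :: l)) / Fintype.card α

section wordAvg

variable {α β : Type*} [Fintype α] [Fintype β]

theorem wordAvg_mono {n : ℕ} {F G : List α → ℝ} (h : ∀ l, l.length = n → F l ≤ G l) :
    wordAvg n F ≤ wordAvg n G := by
  induction n generalizing F G with
  | zero => exact h [] rfl
  | succ n ih =>
    simp only [wordAvg]
    gcongr with a
    exact ih fun l hl => h _ (by simp [hl])

theorem wordAvg_congr {n : ℕ} {F G : List α → ℝ} (h : ∀ l, l.length = n → F l = G l) :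
    wordAvg n F = wordAvg n G :=
  le_antisymm (wordAvg_mono fun l hl => (h l hl).le) (wordAvg_mono fun l hl => (h l hl).ge)

theorem wordAvg_mul_left (n : ℕ) (c : ℝ) (F : List α → ℝ) :
    wordAvg n (fun l => c * F l) = c * wordAvg n F := by
  induction n generalizing F with
  | zero => rfl
  | succ n ih => simp only [wordAvg, ih, ← Finset.mul_sum, mul_div_assoc]

theorem wordAvg_mul_right (n : ℕ) (c : ℝ) (F : List α → ℝ) :
    wordAvg n (fun l => F l * c) = wordAvg n F * c := by
  simp only [mul_comm _ c, wordAvg_mul_left]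

theorem wordAvg_add (n : ℕ) (F G : List α → ℝ) :
    wordAvg n (fun l => F l + G l) = wordAvg n F + wordAvg n G := by
  induction n generalizing F G with
  | zero => rfl
  | succ n ih => simp only [wordAvg, ih, Finset.sum_add_distrib, add_div]

theorem wordAvg_sum {ι : Type*} (n : ℕ) (s : Finset ι) (F : ι → List α → ℝ) :
    wordAvg n (fun l => ∑ i ∈ s, F i l) = ∑ i ∈ s, wordAvg n (F i) := by
  classical
  induction s using Finset.induction_on with
  | empty => simpa using wordAvg_mul_left n (0 : ℝ) (fun _ : List α => 0)
  | insert i s hi ih => simp only [Finset.sum_insert hi, wordAvg_add, ih]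

theorem wordAvg_const [Nonempty α] (n : ℕ) (c : ℝ) :
    wordAvg n (fun _ : List α => c) = c := by
  induction n with
  | zero => rfl
  | succ n ih =>
    have : (Fintype.card α : ℝ) ≠ 0 := by simp
    simp only [wordAvg, ih, Finset.sum_const, Finset.card_univ, nsmul_eq_mul]
    field_simp

theorem wordAvg_append (m n : ℕ) (F : List α → ℝ) :
    wordAvg (m + n) F = wordAvg m fun u => wordAvg n fun v => F (u ++ v) := by
  induction m generalizing F with
  | zero => simp [wordAvg]
  | succ m ih =>
    rw [show m + 1 + n = (m + n) + 1 by ring]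
    simp only [wordAvg, ih, List.cons_append]

theorem wordAvg_comm (m n : ℕ) (F : List α → List β → ℝ) :
    (wordAvg m fun u => wordAvg n fun v => F u v) =
      wordAvg n fun v => wordAvg m fun u => F u v := by
  induction m generalizing F with
  | zero => rfl
  | succ m ih =>
    simp only [wordAvg, ih, div_eq_mul_inv]
    rw [wordAvg_mul_right, wordAvg_sum]

/-- Averaging over words in a product alphabet is averaging over each component. -/
theorem wordAvg_prod (n : ℕ) (F : List α → List β → ℝ) :
    (wordAvg n fun l : List (α × β) => F (l.map Prod.fst) (l.map Prod.snd)) =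
      wordAvg n fun u => wordAvg n fun v => F u v := by
  induction n generalizing F with
  | zero => rfl
  | succ n ih =>
    simp only [wordAvg, List.map_cons, Fintype.sum_prod_type, Fintype.card_prod, Nat.cast_mul]
    simp only [div_eq_mul_inv, wordAvg_mul_right, wordAvg_sum]
    simp only [← Finset.sum_mul, mul_inv]
    rw [mul_comm (Fintype.card α : ℝ)⁻¹, ← mul_assoc]
    congr 2
    refine Finset.sum_congr rfl fun a _ => Finset.sum_congr rfl fun b _ => ?_
    exact ih fun u v => F (a :: u) (b :: v)

/-- Averaging a function of the letterwise image under an equivalence. -/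
theorem wordAvg_equiv (e : α ≃ β) (n : ℕ) (F : List β → ℝ) :
    (wordAvg n fun l : List α => F (l.map e)) = wordAvg n F := by
  induction n generalizing F with
  | zero => rfl
  | succ n ih =>
    simp only [wordAvg, List.map_cons]
    rw [Fintype.card_congr e, ← e.sum_comp]
    congr 1
    exact Finset.sum_congr rfl fun a _ => ih fun l => F (e a :: l)

theorem wordAvg_eq_sum (n : ℕ) (F : List α → ℝ) :
    wordAvg n F = (∑ v : Fin n → α, F (List.ofFn v)) / (Fintype.card α : ℝ) ^ n := by
  induction n generalizing F with
  | zero => simp [wordAvg]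
  | succ n ih =>
    simp only [wordAvg, ih]
    rw [← (Fin.consEquiv fun _ : Fin (n + 1) => α).sum_comp, Fintype.sum_prod_type, pow_succ,
      ← Finset.sum_div, div_div]
    simp [Fin.consEquiv, List.ofFn_succ]

open Classical in
/-- The proportion of the words of length `n` that satisfy `p`. -/
noncomputable def wordProb (n : ℕ) (p : List α → Prop) : ℝ :=
  wordAvg n fun l => if p l then 1 else 0

/-- Markov's inequality in the form used throughout: `F` is a sum of indicators for union bounds and
an exponential for Chernoff bounds. -/
theorem wordProb_le_of_forall_le {n : ℕ} {p : List α → Prop} {F : List α → ℝ}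
    (hF : ∀ l, l.length = n → 0 ≤ F l) (h : ∀ l, l.length = n → p l → 1 ≤ F l) :
    wordProb n p ≤ wordAvg n F := by
  refine wordAvg_mono fun l hl => ?_
  split_ifs with hp
  · exact h l hl hp
  · exact hF l hl

theorem wordProb_mono {n : ℕ} {p q : List α → Prop} (h : ∀ l, l.length = n → p l → q l) :
    wordProb n p ≤ wordProb n q := by
  refine wordProb_le_of_forall_le (fun l _ => by split_ifs <;> norm_num) fun l hl hp => ?_
  rw [if_pos (h l hl hp)]

theorem wordProb_exists_le {ι : Type*} (n : ℕ) (s : Finset ι) (p : ι → List α → Prop) :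
    wordProb n (fun l => ∃ i ∈ s, p i l) ≤ ∑ i ∈ s, wordProb n (p i) := by
  classical
  simp only [wordProb]
  rw [← wordAvg_sum]
  refine wordProb_le_of_forall_le (fun l _ => Finset.sum_nonneg fun i _ => by
    split_ifs <;> norm_num) fun l _ ⟨i, hi, hp⟩ => ?_
  calc (1 : ℝ) = if p i l then 1 else 0 := by rw [if_pos hp]
    _ ≤ _ := Finset.single_le_sum (f := fun i => if p i l then (1 : ℝ) else 0)
      (fun j _ => by split_ifs <;> norm_num) hi

end wordAvg

/-! ### The word of switches -/

/-- The switches made by the walk with steps `e` started at `p`: an entry `(x, true)` is an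
`A`-letter at the site `x`, an entry `(x, false)` is a `B`-letter at the site `x`. -/
def switchWord (k : ℕ) : ℤ → List ℤ → List (ℤ × Bool)
  | _, [] => []
  | p, e :: es =>
    (p, true) :: (p + k, false) :: (p + e, true) :: (p + e + k, false) :: switchWord k (p + e) es

/-- The types of the letters at the site `x`. -/
def lettersAt (x : ℤ) : List (ℤ × Bool) → List Bool
  | [] => []
  | q :: w => if q.1 = x then q.2 :: lettersAt x w else lettersAt x w

/-- The number of `A`-letters that come directly after a `B`-letter, if the last letter before
the word has the given type. -/
def altCount : Bool → List Bool → ℕ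
  | _, [] => 0
  | true, true :: w => altCount true w
  | true, false :: w => altCount false w
  | false, true :: w => altCount true w + 1
  | false, false :: w => altCount false w

/-- The number of alternations `A … A B … B A`. -/
def excCount : List Bool → ℕ
  | [] => 0
  | true :: w => altCount true w
  | false :: w => excCount w

/-- The number of alternations at the site `x` of the walk with steps `e` started at `p`. -/
def siteCount (k : ℕ) (p : ℤ) (e : List ℤ) (x : ℤ) : ℕ :=
  excCount (lettersAt x (switchWord k p e))

theorem switchWord_append (k : ℕ) (p : ℤ) (u v : List ℤ) :
    switchWord k p (u ++ v) = switchWord k p u ++ switchWord k (p + u.sum) v := by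
  induction u generalizing p with
  | nil => simp [switchWord]
  | cons e u ih => simp [switchWord, ih, add_assoc]

theorem lettersAt_append (x : ℤ) (u v : List (ℤ × Bool)) :
    lettersAt x (u ++ v) = lettersAt x u ++ lettersAt x v := by
  induction u with
  | nil => rfl
  | cons q u ih =>
    simp only [List.cons_append, lettersAt, ih]
    split_ifs <;> rfl

theorem excCount_le_altCount (s : Bool) (w : List Bool) : excCount w ≤ altCount s w := by
  induction w generalizing s with
  | nil => simp [excCount]
  | cons b w ih => cases s <;> cases b <;> simp [excCount, altCount, ih]

theorem altCount_false_le (w : List Bool) : altCount true w ≤ altCount false w := by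
  induction w with
  | nil => simp [altCount]
  | cons b w ih => cases b <;> simp [altCount]

/-- Cutting a word can only destroy alternations: `excCount v` discards the `B`-letters before the
first `A` of `v`, which may complete an alternation begun in `u`. -/
theorem altCount_append (s : Bool) (u v : List Bool) :
    altCount s u + excCount v ≤ altCount s (u ++ v) := by
  induction u generalizing s with
  | nil => cases s <;> simpa [altCount] using excCount_le_altCount _ v
  | cons b u ih =>
    have h1 := ih true
    have h2 := ih false
    cases s <;> cases b <;> simp only [altCount, List.cons_append] <;> omega

theorem excCount_append (u v : List Bool) : excCount u + excCount v ≤ excCount (u ++ v) := by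
  induction u with
  | nil => simp [excCount]
  | cons b u ih => cases b <;> simpa [excCount] using (by first | exact ih | exact altCount_append true u v)

theorem siteCount_append (k : ℕ) (p : ℤ) (u v : List ℤ) (x : ℤ) :
    siteCount k p u x + siteCount k (p + u.sum) v x ≤ siteCount k p (u ++ v) x := by
  simp only [siteCount, switchWord_append, lettersAt_append]
  exact excCount_append _ _

/-- The sites at which the walk makes a switch. -/
def switchSites (k : ℕ) (p : ℤ) (e : List ℤ) : Finset ℤ :=
  ((switchWord k p e).map Prod.fst).toFinset

theorem lettersAt_eq_nil {x : ℤ} {w : List (ℤ × Bool)} (h : x ∉ w.map Prod.fst) :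
    lettersAt x w = [] := by
  induction w with
  | nil => rfl
  | cons q w ih =>
    simp only [List.map_cons, List.mem_cons, not_or] at h
    rw [lettersAt, if_neg (Ne.symm h.1), ih h.2]

theorem siteCount_eq_zero {k : ℕ} {p : ℤ} {e : List ℤ} {x : ℤ} (h : x ∉ switchSites k p e) :
    siteCount k p e x = 0 := by
  rw [switchSites, List.mem_toFinset] at h
  rw [siteCount, lettersAt_eq_nil h, excCount]

theorem switchSites_append (k : ℕ) (p : ℤ) (u v : List ℤ) :
    switchSites k p (u ++ v) = switchSites k p u ∪ switchSites k (p + u.sum) v := by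
  simp [switchSites, switchWord_append]

/-- The total number of alternations. -/
def totalCount (k : ℕ) (p : ℤ) (e : List ℤ) : ℕ :=
  ∑ x ∈ switchSites k p e, siteCount k p e x

theorem totalCount_eq_sum {k : ℕ} {p : ℤ} {e : List ℤ} {X : Finset ℤ}
    (hX : switchSites k p e ⊆ X) : totalCount k p e = ∑ x ∈ X, siteCount k p e x :=
  Finset.sum_subset hX fun _ _ h => siteCount_eq_zero h

/-- Superadditivity in time. It makes the count monotone along the path and lets exponential moments
factor over blocks. -/
theorem totalCount_append (k : ℕ) (p : ℤ) (u v : List ℤ) :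
    totalCount k p u + totalCount k (p + u.sum) v ≤ totalCount k p (u ++ v) := by
  have h := switchSites_append k p u v
  rw [totalCount_eq_sum (X := switchSites k p (u ++ v)) (by rw [h]; exact Finset.subset_union_left),
    totalCount_eq_sum (X := switchSites k p (u ++ v)) (by rw [h]; exact Finset.subset_union_right),
    ← Finset.sum_add_distrib]
  exact Finset.sum_le_sum fun x _ => siteCount_append k p u v x

theorem sum_siteCount_le_totalCount (k : ℕ) (p : ℤ) (e : List ℤ) (X : Finset ℤ) :
    ∑ x ∈ X, siteCount k p e x ≤ totalCount k p e := by
  rw [totalCount_eq_sum (X := switchSites k p e ∪ X) Finset.subset_union_left]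
  exact Finset.sum_le_sum_of_subset Finset.subset_union_right

/-! ### Excursions and alternations -/

/-- The `k`-excursions from `x` completed until time `n`. -/
def excursionSet (S : ℕ → ℤ) (k : ℕ) (x : ℤ) (n : ℕ) : Set ℕ :=
  {j : ℕ | S j = x ∧ ∃ r : ℕ, j < r ∧ r ≤ n ∧ S r = x ∧
    (∀ i, j < i → i < r → S i ≠ x) ∧ ∃ i, j ≤ i ∧ i < r ∧ S i = x - k}

theorem excursionSet_finite (S : ℕ → ℤ) (k : ℕ) (x : ℤ) (n : ℕ) :
    (excursionSet S k x n).Finite :=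
  (Set.finite_lt_nat n).subset fun _ ⟨_, _, h1, h2, _⟩ => lt_of_lt_of_le h1 h2

theorem excursionSet_succ (S : ℕ → ℤ) (k : ℕ) (x : ℤ) (n : ℕ) {j : ℕ}
    (h : j + 1 ∈ excursionSet S k x (n + 1)) :
    j ∈ excursionSet (fun i => S (i + 1)) k x n := by
  obtain ⟨h1, r, h2, h3, h4, h5, i, h6, h7, h8⟩ := h
  obtain ⟨r, rfl⟩ : ∃ r', r = r' + 1 := ⟨r - 1, by omega⟩
  obtain ⟨i, rfl⟩ : ∃ i', i = i' + 1 := ⟨i - 1, by omega⟩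
  exact ⟨h1, r, by omega, by omega, h4, fun m hm hm' => h5 (m + 1) (by omega) (by omega),
    i, by omega, by omega, h8⟩

theorem excursionCount_succ_le (S : ℕ → ℤ) (k : ℕ) (x : ℤ) (n : ℕ) :
    excursionCount S k x (n + 1) ≤ excursionCount (fun i => S (i + 1)) k x n + 1 := by
  have hsub : excursionSet S k x (n + 1) ⊆
      insert 0 ((· + 1) '' excursionSet (fun i => S (i + 1)) k x n) := by
    rintro (_ | j) hj
    · exact Or.inl rfl
    · exact Or.inr ⟨j, excursionSet_succ S k x n hj, rfl⟩
  have hfin := (excursionSet_finite (fun i => S (i + 1)) k x n).image (· + 1)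
  refine (Set.ncard_le_ncard hsub (hfin.insert 0)).trans ((Set.ncard_insert_le _ _).trans ?_)
  exact Nat.add_le_add_right
    (Set.ncard_image_le (excursionSet_finite (fun i => S (i + 1)) k x n)) 1

theorem excursionCount_succ_le_of_notMem (S : ℕ → ℤ) (k : ℕ) (x : ℤ) (n : ℕ)
    (h0 : 0 ∉ excursionSet S k x (n + 1)) :
    excursionCount S k x (n + 1) ≤ excursionCount (fun i => S (i + 1)) k x n := by
  have hsub : excursionSet S k x (n + 1) ⊆
      ((· + 1) '' excursionSet (fun i => S (i + 1)) k x n) := by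
    rintro (_ | j) hj
    · exact absurd hj h0
    · exact ⟨j, excursionSet_succ S k x n hj, rfl⟩
  have hfin := (excursionSet_finite (fun i => S (i + 1)) k x n).image (· + 1)
  exact (Set.ncard_le_ncard hsub hfin).trans
    (Set.ncard_image_le (excursionSet_finite (fun i => S (i + 1)) k x n))

theorem excursionCount_zero (S : ℕ → ℤ) (k : ℕ) (x : ℤ) : excursionCount S k x 0 = 0 := by
  have : excursionSet S k x 0 = ∅ := by
    ext j
    simp only [excursionSet, Set.mem_ofPred_eq, Set.mem_empty_iff_false, iff_false]
    rintro ⟨_, r, h1, h2, _⟩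
    omega
  exact (congrArg Set.ncard this).trans (Set.ncard_empty ℕ)

theorem lettersAt_switchWord_cons (k : ℕ) (p e : ℤ) (es : List ℤ) (x : ℤ) :
    lettersAt x (switchWord k p (e :: es)) =
      (if p = x then [true] else []) ++ ((if p + k = x then [false] else []) ++
      ((if p + e = x then [true] else []) ++ ((if p + e + k = x then [false] else []) ++
        lettersAt x (switchWord k (p + e) es)))) := by
  simp only [switchWord, lettersAt]
  split_ifs <;> simp

/-- The three claims support each other in one induction over the path. They differ in the last
letter at `x` before the path starts: none, a `B`, or an `A`. After a `B`, the next visit to `x`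
completes one alternation more; after an `A`, it does so if the path meets `x - k` first. The empty
path is excluded after a `B` because it writes no letters. -/
theorem excursionCount_aux (k : ℕ) (x : ℤ) (e : List ℤ) (S : ℕ → ℤ)
    (h : ∀ (i : ℕ) (hi : i < e.length), S (i + 1) = S i + e[i]) :
    excursionCount S k x e.length ≤ excCount (lettersAt x (switchWord k (S 0) e)) ∧
    (e ≠ [] → (∃ r ≤ e.length, S r = x) →
      excursionCount S k x e.length + 1 ≤
        altCount false (lettersAt x (switchWord k (S 0) e))) ∧
    (k ≠ 0 → (∃ r ≤ e.length, S r = x ∧ (∀ i < r, S i ≠ x) ∧ ∃ i < r, S i = x - k) →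
      excursionCount S k x e.length + 1 ≤
        altCount true (lettersAt x (switchWord k (S 0) e))) := by
  induction e generalizing S with
  | nil =>
    refine ⟨by simp [excursionCount_zero], fun h => absurd rfl h, ?_⟩
    rintro _ ⟨r, hr, _, _, i, hi, _⟩
    simp at hr
    omega
  | cons e es ih =>
    obtain ⟨ih1, ih2, ih3⟩ := ih (fun i => S (i + 1)) fun i hi =>
      h (i + 1) (Nat.succ_lt_succ hi)
    have hS1 : S 1 = S 0 + e := h 0 (Nat.succ_pos _)
    simp only [zero_add] at ih1 ih2 ih3
    have hle := excursionCount_succ_le S k x es.length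
    have hle' := excursionCount_succ_le_of_notMem S k x es.length
    simp only [List.length_cons]
    rw [lettersAt_switchWord_cons, ← hS1]
    set w := lettersAt x (switchWord k (S 1) es) with hw
    set T := excursionCount S k x (es.length + 1) with hT
    set T' := excursionCount (fun i => S (i + 1)) k x es.length with hT'
    have hm := altCount_false_le w
    have hc := excCount_le_altCount true w
    have c1 : T ≤ excCount ((if S 0 = x then [true] else []) ++
        ((if S 0 + k = x then [false] else []) ++ ((if S 1 = x then [true] else []) ++
        ((if S 1 + k = x then [false] else []) ++ w)))) := by
      by_cases h0 : 0 ∈ excursionSet S k x (es.length + 1)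
      · obtain ⟨h1, r, h2, h3, h4, h5, i, h6, h7, h8⟩ := h0
        rw [if_pos h1]
        -- The steps are arbitrary integers here. A return after one step leaves only `i = 0`, which
        -- forces `k = 0`.
        by_cases hr : r = 1
        · subst hr
          have : i = 0 := by omega
          subst this
          rw [if_pos h4, if_pos (by omega), if_pos (by omega)]
          simp only [List.cons_append, List.nil_append, excCount, altCount]
          omega
        · have hS1x : S 1 ≠ x := h5 1 (by omega) (by omega)
          rw [if_neg hS1x]
          -- For `k = 0` the first switch ends with a `B` at `x` itself, so the claim for a
          -- preceding `B` applies. Otherwise the visit to `x - k` is still ahead and the claim for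
          -- a preceding `A` applies.
          by_cases hk : k = 0
          · subst hk
            rw [if_pos (by simpa using h1), if_neg (by simpa using hS1x)]
            simp only [List.singleton_append, List.nil_append, excCount, altCount]
            have := ih2 (by rintro rfl; simp at h3; omega)
              ⟨r - 1, by omega, by rw [Nat.sub_add_cancel (by omega)]; exact h4⟩
            omega
          · have hi : i ≠ 0 := by rintro rfl; omega
            have := ih3 hk ⟨r - 1, by omega, by rw [Nat.sub_add_cancel (by omega)]; exact h4,
              fun i hi => h5 (i + 1) (by omega) (by omega), i - 1, by omega,
              by rw [Nat.sub_add_cancel (by omega)]; exact h8⟩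
            rw [if_neg (by omega)]
            split_ifs <;> simp only [List.singleton_append, List.nil_append, excCount, altCount] <;>
              omega
      · refine (hle' h0).trans (ih1.trans ?_)
        simp only [← List.append_assoc]
        exact (Nat.le_add_left _ _).trans (excCount_append _ _)
    have c2 : (∃ r ≤ es.length + 1, S r = x) → T + 1 ≤ altCount false
        ((if S 0 = x then [true] else []) ++
        ((if S 0 + k = x then [false] else []) ++ ((if S 1 = x then [true] else []) ++
        ((if S 1 + k = x then [false] else []) ++ w)))) := by
      rintro ⟨r, hr, hrx⟩
      by_cases h0 : S 0 = x
      · rw [if_pos h0] at c1 ⊢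
        simp only [List.singleton_append, excCount, altCount] at c1 ⊢
        omega
      · have hTT : T ≤ T' := hle' fun hh => h0 hh.1
        rw [if_neg h0]
        by_cases h1 : S 1 = x
        · rw [if_pos h1]
          split_ifs <;> simp only [List.singleton_append, List.nil_append, altCount] <;> omega
        · have hr2 : 2 ≤ r := by
            rcases r with _ | _ | r
            · exact absurd hrx h0
            · exact absurd hrx h1
            · omega
          have := ih2 (by rintro rfl; simp at hr; omega)
            ⟨r - 1, by omega, by rw [Nat.sub_add_cancel (by omega)]; exact hrx⟩
          rw [if_neg h1]
          split_ifs <;> simp only [List.singleton_append, List.nil_append, altCount] <;> omega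
    refine ⟨c1, fun _ => c2, ?_⟩
    rintro hk ⟨r, hr, hrx, hne, i, hi, hix⟩
    have h0 : S 0 ≠ x := hne 0 (by omega)
    have hTT : T ≤ T' := hle' fun hh => h0 hh.1
    -- Starting at `x - k`, the first switch writes a `B` at `x`, and the claim for a preceding `B`
    -- takes over.
    by_cases hb : S 0 = x - k
    · have := c2 ⟨r, hr, hrx⟩
      rw [if_neg h0, if_pos (by omega)] at this ⊢
      simpa only [List.singleton_append, List.nil_append, altCount] using this
    · have hi0 : i ≠ 0 := by rintro rfl; exact hb hix
      have h1 : S 1 ≠ x := hne 1 (by omega)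
      have := ih3 hk ⟨r - 1, by omega, by rw [Nat.sub_add_cancel (by omega)]; exact hrx,
        fun i hi => hne (i + 1) (by omega), i - 1, by omega,
        by rw [Nat.sub_add_cancel (by omega)]; exact hix⟩
      rw [if_neg h0, if_neg (by omega), if_neg h1]
      split_ifs <;> simp only [List.singleton_append, List.nil_append, altCount] <;> omega

theorem excursionCount_le_siteCount (k : ℕ) (x : ℤ) (e : List ℤ) (S : ℕ → ℤ)
    (h : ∀ (i : ℕ) (hi : i < e.length), S (i + 1) = S i + e[i]) :
    excursionCount S k x e.length ≤ siteCount k (S 0) e x :=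
  (excursionCount_aux k x e S h).1

/-! ### Upper bound for the number of alternations at a site -/

/-- The step of the simple random walk that corresponds to a coin. -/
def coinStep (b : Bool) : ℤ := if b then 1 else -1

theorem wordAvg_bool_succ (n : ℕ) (F : List Bool → ℝ) :
    wordAvg (n + 1) F =
      (wordAvg n (fun l => F (true :: l)) + wordAvg n (fun l => F (false :: l))) / 2 := by
  simp [wordAvg]

/-- The distance that a walk at `y` has to cover in order to complete `m` alternations at `x`, if
the last letter at `x` has the given type. -/
def altDist (k : ℕ) (x : ℤ) : Bool → ℕ → ℤ → ℝ
  | _, 0, _ => 0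
  | true, m + 1, y => |(y : ℝ) - (x - k)| + k + 2 * k * m
  | false, m + 1, y => |(y : ℝ) - x| + 2 * k * m

/-- The letters at the site `x` of one switch at the position `y`. -/
def siteSwitch (k : ℕ) (x y : ℤ) : List Bool :=
  (if y = x then [true] else []) ++ (if y + k = x then [false] else [])

theorem lettersAt_switchWord_cons' (k : ℕ) (p e : ℤ) (es : List ℤ) (x : ℤ) :
    lettersAt x (switchWord k p (e :: es)) =
      siteSwitch k x p ++ (siteSwitch k x (p + e) ++ lettersAt x (switchWord k (p + e) es)) := by
  simp [lettersAt_switchWord_cons, siteSwitch]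

/-- A switch may change the last letter and the number of alternations still required, but not the
remaining distance. Afterwards the walk is not at its next target (`x - k` after an `A`, `x` after a
`B`), so one step does not meet the kink of the absolute value. -/
theorem exists_altDist_eq {k : ℕ} (hk : k ≠ 0) (x : ℤ) (s : Bool) (m : ℕ) (y : ℤ) :
    ∃ s' m', (∀ w, m ≤ altCount s (siteSwitch k x y ++ w) → m' ≤ altCount s' w) ∧
      altDist k x s' m' y = altDist k x s m y ∧
      (m' = 0 ∨ (s' = true ∧ y ≠ x - k) ∨ (s' = false ∧ y ≠ x)) := by
  rcases m with _ | m
  · exact ⟨s, 0, by simp, by cases s <;> simp [altDist], Or.inl rfl⟩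
  by_cases h1 : y = x
  · subst h1
    have h2 : y + (k : ℤ) ≠ y := by omega
    have h3 : y ≠ y - (k : ℤ) := by omega
    cases s
    · refine ⟨true, m, ?_, ?_, Or.inr (Or.inl ⟨rfl, h3⟩)⟩
      · intro w hw
        simpa [siteSwitch, h2, altCount, hk] using hw
      · rcases m with _ | m
        · simp [altDist]
        · simp [altDist]; ring
    · refine ⟨true, m + 1, ?_, rfl, Or.inr (Or.inl ⟨rfl, h3⟩)⟩
      intro w hw
      simpa [siteSwitch, h2, altCount, hk] using hw
  by_cases h2 : y + k = x
  · subst h2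
    refine ⟨false, m + 1, ?_, ?_, Or.inr (Or.inr ⟨rfl, h1⟩)⟩
    · intro w hw
      cases s <;> simpa [siteSwitch, h1, altCount, hk] using hw
    · cases s <;> simp [altDist]
  · refine ⟨s, m + 1, ?_, rfl, Or.inr ?_⟩
    · intro w hw
      simpa [siteSwitch, h1, h2] using hw
    · cases s
      · exact Or.inr ⟨rfl, h1⟩
      · exact Or.inl ⟨rfl, by omega⟩

/-- Away from the kink, a fair step changes the distance by exactly `±1`, which produces the factor
`cosh a`. -/
theorem exp_abs_step_le (a : ℝ) {y z : ℤ} (h : y ≠ z) (c : ℝ) :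
    (Real.exp (-a * (|((y + 1 : ℤ) : ℝ) - z| + c)) +
      Real.exp (-a * (|((y + -1 : ℤ) : ℝ) - z| + c))) / 2 =
      Real.cosh a * Real.exp (-a * (|(y : ℝ) - z| + c)) := by
  rw [Real.cosh_eq, div_mul_eq_mul_div, add_mul, ← Real.exp_add, ← Real.exp_add]
  rcases lt_or_gt_of_ne h with h | h
  · have h' : (y : ℝ) + 1 ≤ z := by exact_mod_cast h
    push_cast
    rw [abs_of_nonpos (by linarith), abs_of_nonpos (by linarith), abs_of_nonpos (by linarith)]
    ring_nf
  · have h' : (z : ℝ) + 1 ≤ y := by exact_mod_cast h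
    push_cast
    rw [abs_of_nonneg (by linarith), abs_of_nonneg (by linarith), abs_of_nonneg (by linarith)]
    ring_nf

theorem exp_altDist_step_le (a : ℝ) {k : ℕ} {x : ℤ} {s : Bool} {m : ℕ} {y : ℤ}
    (h : m = 0 ∨ (s = true ∧ y ≠ x - k) ∨ (s = false ∧ y ≠ x)) :
    (Real.exp (-a * altDist k x s m (y + 1)) + Real.exp (-a * altDist k x s m (y + -1))) / 2 ≤
      Real.cosh a * Real.exp (-a * altDist k x s m y) := by
  rcases m with _ | m
  · have : ∀ y, altDist k x s 0 y = 0 := by cases s <;> simp [altDist]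
    simp [this]
  rcases h with h | ⟨rfl, h⟩ | ⟨rfl, h⟩
  · simp at h
  · have := exp_abs_step_le a h (k + 2 * k * m)
    simp only [altDist, add_assoc]
    push_cast at this ⊢
    exact this.le
  · exact (exp_abs_step_le a h (2 * k * m)).le

/-- A supermartingale bound: in each step the mean of `exp (-a * altDist)` grows at most by the
factor `cosh a`, and the exponential equals `1` once no alternation is required. -/
theorem wordProb_altCount_le (a : ℝ) {k : ℕ} (hk : k ≠ 0) (x : ℤ) (n : ℕ) (s : Bool) (m : ℕ)
    (p : ℤ) :
    wordProb n (fun l : List Bool =>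
        m ≤ altCount s (lettersAt x (switchWord k p (l.map coinStep)))) ≤
      Real.cosh a ^ n * Real.exp (-a * altDist k x s m p) := by
  induction n generalizing s m p with
  | zero =>
    rcases m with _ | m
    · have : altDist k x s 0 p = 0 := by cases s <;> simp [altDist]
      simp [wordProb, wordAvg, this]
    · simp only [wordProb, wordAvg, List.map_nil, switchWord, lettersAt, altCount]
      rw [if_neg (by simp)]
      positivity
  | succ n ih =>
    obtain ⟨s₁, m₁, h1, h2, h3⟩ := exists_altDist_eq hk x s m p
    have key : ∀ b : Bool, wordProb n (fun l : List Bool => m ≤ altCount s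
        (lettersAt x (switchWord k p ((b :: l).map coinStep)))) ≤
        Real.cosh a ^ n * Real.exp (-a * altDist k x s₁ m₁ (p + coinStep b)) := by
      intro b
      -- Each step switches twice, at its departure and at its arrival, so the state is normalised
      -- twice.
      obtain ⟨s₂, m₂, h4, h5, -⟩ := exists_altDist_eq hk x s₁ m₁ (p + coinStep b)
      rw [← h5]
      refine le_trans (wordProb_mono fun l _ hl => ?_) (ih s₂ m₂ (p + coinStep b))
      rw [List.map_cons, lettersAt_switchWord_cons'] at hl
      exact h4 _ (h1 _ hl)
    have := exp_altDist_step_le a h3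
    rw [h2] at this
    rw [wordProb, wordAvg_bool_succ, pow_succ]
    have e1 := key true
    have e2 := key false
    simp only [wordProb] at e1 e2
    simp only [coinStep, if_true] at e1
    simp only [coinStep, Bool.false_eq_true, if_false] at e2
    have hc : 0 ≤ Real.cosh a ^ n := by positivity
    have := mul_le_mul_of_nonneg_left this hc
    simp only [coinStep] at *
    linarith

/-- The probability of `m` alternations at a given site. -/
theorem wordProb_siteCount_le (a : ℝ) (ha : 0 ≤ a) {k : ℕ} (hk : k ≠ 0) (x : ℤ) (n m : ℕ)
    (p : ℤ) :
    wordProb n (fun l : List Bool => m + 1 ≤ siteCount k p (l.map coinStep) x) ≤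
      Real.exp (a ^ 2 / 2 * n - a * k * (2 * m + 1)) := by
  calc _ ≤ wordProb n (fun l : List Bool =>
        m + 1 ≤ altCount true (lettersAt x (switchWord k p (l.map coinStep)))) :=
        wordProb_mono fun l _ h => h.trans (excCount_le_altCount _ _)
    _ ≤ _ := wordProb_altCount_le a hk x n true (m + 1) p
    _ ≤ Real.exp (a ^ 2 / 2) ^ n * Real.exp (-a * (k * (2 * m + 1))) := by
        have h1 : (k : ℝ) * (2 * m + 1) ≤ altDist k x true (m + 1) p := by
          simp only [altDist]
          linarith [abs_nonneg ((p : ℝ) - (x - k))]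
        have h2 := mul_le_mul_of_nonneg_left h1 ha
        refine mul_le_mul (pow_le_pow_left₀ (Real.cosh_pos a).le (Real.cosh_le_exp_half_sq a) n)
          (Real.exp_le_exp.mpr (by linarith)) (Real.exp_pos _).le (by positivity)
    _ = _ := by
        rw [← Real.exp_nat_mul, ← Real.exp_add]
        ring_nf

/-! ### Moments of the simple random walk -/

/-- The shift `c` absorbs the first step in the induction; only `c = 0` is used later. -/
theorem wordAvg_sum_sq (n : ℕ) (c : ℝ) :
    wordAvg n (fun l : List Bool => (c + ((l.map coinStep).sum : ℤ)) ^ 2) = c ^ 2 + n := by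
  induction n generalizing c with
  | zero => simp [wordAvg]
  | succ n ih =>
    have h1 := ih (c + 1)
    have h2 := ih (c - 1)
    rw [wordAvg_bool_succ]
    simp only [List.map_cons, List.sum_cons, coinStep, if_true, Bool.false_eq_true, if_false]
    simp only [Int.cast_add, Int.cast_one, Int.cast_neg, ← add_assoc, ← sub_eq_add_neg]
    rw [h1, h2]
    push_cast
    ring

theorem wordAvg_sum_pow_four (n : ℕ) (c : ℝ) :
    wordAvg n (fun l : List Bool => (c + ((l.map coinStep).sum : ℤ)) ^ 4) =
      c ^ 4 + 6 * c ^ 2 * n + 3 * n ^ 2 - 2 * n := by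
  induction n generalizing c with
  | zero => simp [wordAvg]
  | succ n ih =>
    have h1 := ih (c + 1)
    have h2 := ih (c - 1)
    rw [wordAvg_bool_succ]
    simp only [List.map_cons, List.sum_cons, coinStep, if_true, Bool.false_eq_true, if_false]
    simp only [Int.cast_add, Int.cast_one, Int.cast_neg, ← add_assoc, ← sub_eq_add_neg]
    rw [h1, h2]
    push_cast
    ring

theorem wordProb_neg (n : ℕ) (c : ℤ) :
    wordProb n (fun l : List Bool => (l.map coinStep).sum ≤ -c) =
      wordProb n (fun l : List Bool => c ≤ (l.map coinStep).sum) := by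
  have hneg : ∀ l : List Bool, ((l.map Equiv.boolNot).map coinStep).sum =
      -(l.map coinStep).sum := by
    intro l
    induction l with
    | nil => rfl
    | cons b l ih =>
      simp only [List.map_cons, List.sum_cons, ih]
      cases b <;> simp [coinStep] <;> ring
  rw [wordProb, wordProb, ← wordAvg_equiv Equiv.boolNot]
  simp only [hneg]
  refine wordAvg_congr fun l _ => ?_
  congr 1
  exact propext ⟨fun h => by linarith, fun h => by linarith⟩

/-- A second moment argument: with `z = X² / n`, the mean of `z` is `1` and that of `z²` is at most
`3`, so `|X| ≥ 2k` has probability at least `3 / 20`. Symmetry halves this. -/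
theorem le_wordProb_sum {k : ℕ} (hk : k ≠ 0) :
    3 / 40 ≤ wordProb (16 * k ^ 2) (fun l : List Bool => (2 * k : ℤ) ≤ (l.map coinStep).sum) := by
  set n := 16 * k ^ 2 with hn
  have hk' : (0 : ℝ) < k := by positivity
  have hn' : (n : ℝ) = 16 * (k : ℝ) ^ 2 := by rw [hn]; push_cast; ring
  have hn0 : (0 : ℝ) < n := by rw [hn']; positivity
  have h2 := wordAvg_sum_sq n 0
  have h4 := wordAvg_sum_pow_four n 0
  simp only [zero_add] at h2 h4
  have hneg := wordProb_neg n (2 * k)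
  set P := wordProb n (fun l : List Bool => (2 * k : ℤ) ≤ (l.map coinStep).sum) with hP
  -- The indicator of `z > 1 / 4` is at least `z - z² / 5 - 1 / 4`, whose maximum is `1`, at `z = 5
  -- / 2`. As `n = 16 k²`, `z > 1 / 4` means `|X| > 2k`.
  have key : wordAvg n (fun l : List Bool => (1 / (n : ℝ)) * (((l.map coinStep).sum : ℤ) : ℝ) ^ 2 +
      ((-1 / (5 * (n : ℝ) ^ 2)) * (((l.map coinStep).sum : ℤ) : ℝ) ^ 4 + (-1 / 4))) ≤ P + P := by
    nth_rewrite 1 [← hneg]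
    rw [hP, wordProb, wordProb, ← wordAvg_add]
    refine wordAvg_mono fun l _ => ?_
    set X := (l.map coinStep).sum with hX
    have hz : (1 / (n : ℝ)) * (X : ℝ) ^ 2 + ((-1 / (5 * (n : ℝ) ^ 2)) * (X : ℝ) ^ 4 + (-1 / 4)) =
        (X : ℝ) ^ 2 / n - ((X : ℝ) ^ 2 / n) ^ 2 / 5 - 1 / 4 := by
      field_simp
      ring
    rw [hz]
    set z := (X : ℝ) ^ 2 / n with hzdef
    by_cases h : z ≤ 1 / 4
    · have : z - z ^ 2 / 5 - 1 / 4 ≤ 0 := by nlinarith [sq_nonneg z]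
      refine this.trans ?_
      positivity
    · have hle : z - z ^ 2 / 5 - 1 / 4 ≤ 1 := by nlinarith [sq_nonneg (z - 5 / 2)]
      have hX2 : (2 * (k : ℝ)) ^ 2 < (X : ℝ) ^ 2 := by
        rw [not_le, hzdef, lt_div_iff₀ hn0, hn'] at h
        linarith
      have habs : 2 * (k : ℝ) < |(X : ℝ)| := by
        rw [← abs_of_pos (by positivity : (0 : ℝ) < 2 * k)]
        exact sq_lt_sq.mp hX2
      refine hle.trans ?_
      rcases lt_abs.mp habs with h' | h'
      · have : 2 * (k : ℤ) ≤ X := by exact_mod_cast h'.le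
        rw [if_pos this]
        split_ifs <;> norm_num
      · have : X ≤ -(2 * (k : ℤ)) := by
          have : 2 * (k : ℤ) < -X := by exact_mod_cast h'
          linarith
        rw [if_pos this]
        split_ifs <;> norm_num
  rw [wordAvg_add, wordAvg_add, wordAvg_mul_left, wordAvg_mul_left, wordAvg_const, h2, h4] at key
  have : (1 / (n : ℝ)) * (0 ^ 2 + n) + (-1 / (5 * (n : ℝ) ^ 2) *
      (0 ^ 4 + 6 * 0 ^ 2 * n + 3 * n ^ 2 - 2 * n) + -1 / 4) = 3 / 20 + 2 / (5 * n) := by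
    field_simp
    ring
  rw [this] at key
  have : 0 < 2 / (5 * (n : ℝ)) := by positivity
  linarith

/-- After flipping the coins of the first block, the event reads `2k ≤ X u ≤ X v`. Both sums reach
`2k` with probability at least `(3 / 40)²`, and exchanging the blocks shows that the second is the
larger one at least half of the time. -/
theorem le_wordProb_down_up {k : ℕ} (hk : k ≠ 0) :
    9 / 3200 ≤ wordAvg (16 * k ^ 2) (fun u : List Bool => wordProb (16 * k ^ 2)
      (fun v : List Bool => (u.map coinStep).sum ≤ -(2 * k : ℤ) ∧
        0 ≤ (u.map coinStep).sum + (v.map coinStep).sum)) := by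
  classical
  set n := 16 * k ^ 2
  have hneg : ∀ l : List Bool, ((l.map Equiv.boolNot).map coinStep).sum =
      -(l.map coinStep).sum := by
    intro l
    induction l with
    | nil => rfl
    | cons b l ih =>
      simp only [List.map_cons, List.sum_cons, ih]
      cases b <;> simp [coinStep] <;> ring
  have h0 := le_wordProb_sum hk
  set X : List Bool → ℤ := fun l => (l.map coinStep).sum with hX
  set P := wordProb n (fun l : List Bool => (2 * k : ℤ) ≤ X l) with hP
  have e1 : (wordAvg n fun u : List Bool => wordProb n
      (fun v : List Bool => X u ≤ -(2 * k : ℤ) ∧ 0 ≤ X u + X v)) =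
      wordAvg n fun u : List Bool => wordAvg n fun v : List Bool =>
        if (2 * k : ℤ) ≤ X u ∧ X u ≤ X v then (1 : ℝ) else 0 := by
    rw [← wordAvg_equiv Equiv.boolNot]
    refine wordAvg_congr fun u _ => wordAvg_congr fun v _ => ?_
    have : X (u.map Equiv.boolNot) = - X u := hneg u
    rw [this]
    congr 1
    exact propext ⟨fun h => ⟨by linarith [h.1], by linarith [h.2]⟩,
      fun h => ⟨by linarith [h.1], by linarith [h.2]⟩⟩
  have e2 := wordAvg_comm n n (fun u v : List Bool =>
    if (2 * k : ℤ) ≤ X u ∧ X u ≤ X v then (1 : ℝ) else 0)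
  have e3 : P * P ≤ wordAvg n (fun u : List Bool => (wordAvg n fun v : List Bool =>
        if (2 * k : ℤ) ≤ X u ∧ X u ≤ X v then (1 : ℝ) else 0) +
        wordAvg n fun v : List Bool =>
        if (2 * k : ℤ) ≤ X v ∧ X v ≤ X u then (1 : ℝ) else 0) := by
    nth_rewrite 1 [hP]
    rw [wordProb, ← wordAvg_mul_right]
    refine wordAvg_mono fun u _ => ?_
    rw [hP, wordProb, ← wordAvg_mul_left, ← wordAvg_add]
    refine wordAvg_mono fun v _ => ?_
    by_cases h1 : (2 * k : ℤ) ≤ X u <;> by_cases h2 : (2 * k : ℤ) ≤ X v <;>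
      simp only [h1, h2, true_and, false_and, if_true, if_false]
    · rcases le_total (X u) (X v) with h | h
      · rw [if_pos h]
        split_ifs <;> norm_num
      · rw [if_pos h]
        split_ifs <;> norm_num
    · simp
      split_ifs <;> norm_num
    · simp
      split_ifs <;> norm_num
    · simp
  rw [wordAvg_add, ← e2] at e3
  change 9 / 3200 ≤ wordAvg n fun u : List Bool => wordProb n
      (fun v : List Bool => X u ≤ -(2 * k : ℤ) ∧ 0 ≤ X u + X v)
  rw [e1]
  nlinarith

/-! ### Lower bound for the total number of alternations -/

/-- Discrete intermediate value theorem: unit steps cannot jump over `x`. -/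
theorem exists_split_down {e : List ℤ} (he : ∀ s ∈ e, s = 1 ∨ s = -1) {p x : ℤ} (hp : x ≤ p)
    (hq : p + e.sum ≤ x) : ∃ u v, e = u ++ v ∧ p + u.sum = x := by
  induction e generalizing p with
  | nil => exact ⟨[], [], rfl, by simp at hq ⊢; omega⟩
  | cons s e ih =>
    rcases eq_or_lt_of_le hp with rfl | hlt
    · exact ⟨[], s :: e, rfl, by simp⟩
    · have hs := he s (by simp)
      obtain ⟨u, v, rfl, h⟩ := ih (fun t ht => he t (by simp [ht])) (p := p + s)
        (by omega) (by simpa [add_assoc] using hq)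
      exact ⟨s :: u, v, rfl, by simpa [add_assoc] using h⟩

theorem exists_split_up {e : List ℤ} (he : ∀ s ∈ e, s = 1 ∨ s = -1) {p x : ℤ} (hp : p ≤ x)
    (hq : x ≤ p + e.sum) : ∃ u v, e = u ++ v ∧ p + u.sum = x := by
  induction e generalizing p with
  | nil => exact ⟨[], [], rfl, by simp at hq ⊢; omega⟩
  | cons s e ih =>
    rcases eq_or_lt_of_le hp with rfl | hlt
    · exact ⟨[], s :: e, rfl, by simp⟩
    · have hs := he s (by simp)
      obtain ⟨u, v, rfl, h⟩ := ih (fun t ht => he t (by simp [ht])) (p := p + s)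
        (by omega) (by simpa [add_assoc] using hq)
      exact ⟨s :: u, v, rfl, by simpa [add_assoc] using h⟩

/-- After a `B`-letter the earlier history no longer matters. -/
theorem altCount_false_le_append (s : Bool) (u w : List Bool) :
    altCount false w ≤ altCount s (u ++ false :: w) := by
  induction u generalizing s with
  | nil => cases s <;> simp [altCount]
  | cons b u ih =>
    have h1 := ih true
    have h2 := ih false
    cases s <;> cases b <;> simp only [altCount, List.cons_append] <;> omega

theorem one_le_altCount_false {w : List Bool} (h : true ∈ w) : 1 ≤ altCount false w := by
  induction w with
  | nil => simp at h
  | cons b w ih =>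
    cases b
    · simpa [altCount] using ih (by simpa using h)
    · simp [altCount]

theorem true_mem_lettersAt {k : ℕ} {p x : ℤ} {e : List ℤ} (he : e ≠ []) (h : p + e.sum = x) :
    true ∈ lettersAt x (switchWord k p e) := by
  induction e generalizing p with
  | nil => exact absurd rfl he
  | cons s e ih =>
    rw [lettersAt_switchWord_cons']
    by_cases h' : e = []
    · subst h'
      have : p + s = x := by simpa using h
      simp [siteSwitch, this]
    · have := ih (p := p + s) h' (by simpa [add_assoc] using h)
      simp [this]

/-- A walk that goes down by `2k` and up again completes an alternation at `k + 1` sites. -/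
theorem one_le_siteCount {k : ℕ} (hk : k ≠ 0) {p x : ℤ} {u v : List ℤ}
    (hu : ∀ s ∈ u, s = 1 ∨ s = -1) (hv : ∀ s ∈ v, s = 1 ∨ s = -1)
    (h1 : u.sum ≤ -(2 * k : ℤ)) (h2 : 0 ≤ u.sum + v.sum) (hx : p - k ≤ x) (hx' : x ≤ p) :
    1 ≤ siteCount k p (u ++ v) x := by
  -- The path meets `x`, then `x - k ≥ p - 2k`, then `x` again, and so writes `A`, `B`, `A` at `x`.
  obtain ⟨u₁, u', rfl, hu₁⟩ := exists_split_down hu hx' (by omega)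
  have hu' : ∀ s ∈ u', s = 1 ∨ s = -1 := fun s hs => hu s (by simp [hs])
  simp only [List.sum_append] at h1 h2
  obtain ⟨u₂, u₃, rfl, hu₂⟩ := exists_split_down hu' (p := x) (x := x - k) (by omega) (by omega)
  simp only [List.sum_append] at h1 h2
  have hw : ∀ s ∈ u₃ ++ v, s = 1 ∨ s = -1 := by
    intro s hs
    rcases List.mem_append.mp hs with hs | hs
    · exact hu' s (by simp [hs])
    · exact hv s hs
  obtain ⟨w₁, w₂, hww, hw₁⟩ := exists_split_up hw (p := x - k) (x := x) (by omega)
    (by simp only [List.sum_append]; omega)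
  have : (u₁ ++ (u₂ ++ u₃)) ++ v = u₁ ++ ((u₂ ++ w₁) ++ w₂) := by
    simp only [List.append_assoc]
    rw [hww]
  rw [this]
  have a1 := siteCount_append k p u₁ ((u₂ ++ w₁) ++ w₂) x
  have a2 := siteCount_append k (p + u₁.sum) (u₂ ++ w₁) w₂ x
  rw [hu₁] at a1 a2
  suffices 1 ≤ siteCount k x (u₂ ++ w₁) x by omega
  have hu₂n : u₂ ≠ [] := by
    rintro rfl
    simp at hu₂
    omega
  have hw₁n : w₁ ≠ [] := by
    rintro rfl
    simp at hw₁
    omega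
  obtain ⟨c, cs, rfl⟩ := List.exists_cons_of_ne_nil hu₂n
  have hmem := true_mem_lettersAt (k := k) hw₁n hw₁
  obtain ⟨d, ds, rfl⟩ := List.exists_cons_of_ne_nil hw₁n
  rw [siteCount, switchWord_append, lettersAt_append, hu₂, lettersAt_switchWord_cons']
  rw [lettersAt_switchWord_cons'] at hmem ⊢
  have h3 : ¬ (x - (k : ℤ) = x) := by omega
  have h4 : siteSwitch k x (x - k) = [false] := by simp [siteSwitch, hk]
  have h5 : siteSwitch k x x = [true] := by simp [siteSwitch, hk]
  rw [h4, List.singleton_append] at hmem ⊢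
  rw [h5, List.singleton_append, List.cons_append, excCount]
  refine (one_le_altCount_false ?_).trans (altCount_false_le_append true _ _)
  simpa using hmem

theorem le_totalCount {k : ℕ} (hk : k ≠ 0) (p : ℤ) {u v : List ℤ}
    (hu : ∀ s ∈ u, s = 1 ∨ s = -1) (hv : ∀ s ∈ v, s = 1 ∨ s = -1)
    (h1 : u.sum ≤ -(2 * k : ℤ)) (h2 : 0 ≤ u.sum + v.sum) : k + 1 ≤ totalCount k p (u ++ v) := by
  refine le_trans ?_ (sum_siteCount_le_totalCount k p (u ++ v) (Finset.Icc (p - k) p))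
  calc k + 1 = ∑ _x ∈ Finset.Icc (p - (k : ℤ)) p, 1 := by
        simp; omega
    _ ≤ _ := Finset.sum_le_sum fun x hx => by
        rw [Finset.mem_Icc] at hx
        exact one_le_siteCount hk hu hv h1 h2 hx.1 hx.2

theorem coinStep_eq (l : List Bool) : ∀ s ∈ l.map coinStep, s = 1 ∨ s = -1 := by
  intro s hs
  obtain ⟨b, -, rfl⟩ := List.mem_map.mp hs
  cases b <;> simp [coinStep]

theorem exp_neg_one_le : Real.exp (-1) ≤ 1 / 2 := by
  rw [Real.exp_neg, ← one_div]
  exact one_div_le_one_div_of_le (by norm_num) (by linarith [Real.add_one_le_exp (1 : ℝ)])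

/-- With probability at least `9 / 3200` the count reaches `k + 1`, and then the exponential is at
most `1 / e ≤ 1 / 2`. Hence the mean is at most `1 - 9 / 6400`. -/
theorem wordAvg_exp_totalCount_block {k : ℕ} (hk : k ≠ 0) (p : ℤ) :
    wordAvg (16 * k ^ 2 + 16 * k ^ 2) (fun l : List Bool =>
      Real.exp (-(totalCount k p (l.map coinStep) / (k + 1 : ℝ)))) ≤
      Real.exp (-(9 / 6400)) := by
  have h := le_wordProb_down_up hk
  set n := 16 * k ^ 2
  rw [wordAvg_append]
  calc _ ≤ wordAvg n (fun u : List Bool => 1 + (-1 / 2) * wordProb n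
        (fun v : List Bool => (u.map coinStep).sum ≤ -(2 * k : ℤ) ∧
        0 ≤ (u.map coinStep).sum + (v.map coinStep).sum)) := by
        refine wordAvg_mono fun u _ => ?_
        rw [wordProb, ← wordAvg_mul_left]
        nth_rewrite 2 [← wordAvg_const (α := Bool) n 1]
        rw [← wordAvg_add]
        refine wordAvg_mono fun v _ => ?_
        split_ifs with hs
        · have := le_totalCount hk p (coinStep_eq u) (coinStep_eq v) hs.1 hs.2
          rw [List.map_append]
          have h1 : (1 : ℝ) ≤ totalCount k p (u.map coinStep ++ v.map coinStep) / (k + 1 : ℝ) := by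
            rw [le_div_iff₀ (by positivity), one_mul]
            exact_mod_cast this
          have := Real.exp_le_exp.mpr (neg_le_neg h1)
          linarith [exp_neg_one_le]
        · rw [mul_zero, add_zero, Real.exp_le_one_iff, neg_nonpos]
          positivity
    _ ≤ 1 + (-(9 / 6400)) := by
        rw [wordAvg_add, wordAvg_mul_left, wordAvg_const]
        linarith
    _ ≤ _ := by linarith [Real.add_one_le_exp (-(9 / 6400) : ℝ)]

/-- The block bound is uniform in the starting point, so by superadditivity it multiplies over
consecutive blocks. -/
theorem wordAvg_exp_totalCount {k : ℕ} (hk : k ≠ 0) (N : ℕ) (p : ℤ) :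
    wordAvg (N * (16 * k ^ 2 + 16 * k ^ 2)) (fun l : List Bool =>
      Real.exp (-(totalCount k p (l.map coinStep) / (k + 1 : ℝ)))) ≤
      Real.exp (-(9 / 6400) * N) := by
  induction N generalizing p with
  | zero => simp [wordAvg, totalCount, switchSites, switchWord]
  | succ N ih =>
    rw [Nat.succ_mul, add_comm, wordAvg_append]
    calc _ ≤ wordAvg (16 * k ^ 2 + 16 * k ^ 2) (fun u : List Bool =>
          Real.exp (-(totalCount k p (u.map coinStep) / (k + 1 : ℝ))) *
            Real.exp (-(9 / 6400) * N)) := by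
          refine wordAvg_mono fun u _ => ?_
          refine le_trans ?_ (mul_le_mul_of_nonneg_left (ih (p + (u.map coinStep).sum))
            (Real.exp_pos _).le)
          rw [← wordAvg_mul_left]
          refine wordAvg_mono fun v _ => ?_
          rw [← Real.exp_add, Real.exp_le_exp, List.map_append, ← neg_add, neg_le_neg_iff,
            ← add_div]
          gcongr
          exact_mod_cast totalCount_append k p _ _
      _ ≤ Real.exp (-(9 / 6400)) * Real.exp (-(9 / 6400) * N) := by
          rw [wordAvg_mul_right]
          gcongr
          exact wordAvg_exp_totalCount_block hk p
      _ = _ := by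
          rw [← Real.exp_add]
          congr 1
          push_cast
          ring

/-- With high probability, the total number of alternations is of order `n / k`. -/
theorem wordProb_totalCount_le {k : ℕ} (hk : k ≠ 0) {N n : ℕ} (hN : N * (32 * k ^ 2) ≤ n)
    (p : ℤ) :
    wordProb n (fun l : List Bool =>
      (totalCount k p (l.map coinStep) : ℝ) ≤ 9 / 12800 * (k + 1) * N) ≤
      Real.exp (-(9 / 12800) * N) := by
  obtain ⟨r, rfl⟩ : ∃ r, n = N * (16 * k ^ 2 + 16 * k ^ 2) + r :=
    ⟨n - N * (32 * k ^ 2), by rw [show 16 * k ^ 2 + 16 * k ^ 2 = 32 * k ^ 2 by ring]; omega⟩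
  set m := N * (16 * k ^ 2 + 16 * k ^ 2)
  -- Chernoff bound at half of the exponential rate: `9 / 12800` is half of `9 / 6400`. The `r`
  -- remaining steps can only increase the count.
  calc _ ≤ wordAvg (m + r) (fun l : List Bool => Real.exp (9 / 12800 * N) *
        Real.exp (-(totalCount k p (l.map coinStep) / (k + 1 : ℝ)))) := by
        refine wordProb_le_of_forall_le (fun l _ => by positivity) fun l _ hl => ?_
        rw [← Real.exp_add, Real.one_le_exp_iff]
        have : (totalCount k p (l.map coinStep) : ℝ) / (k + 1) ≤ 9 / 12800 * N := by
          rw [div_le_iff₀ (by positivity)]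
          linarith
        linarith
    _ ≤ Real.exp (9 / 12800 * N) * Real.exp (-(9 / 6400) * N) := by
        rw [wordAvg_mul_left, wordAvg_append]
        gcongr
        refine le_trans (wordAvg_mono fun u _ => ?_) (wordAvg_exp_totalCount hk N p)
        rw [← wordAvg_const (α := Bool) r
          (Real.exp (-(totalCount k p (u.map coinStep) / (k + 1 : ℝ))))]
        refine wordAvg_mono fun v _ => ?_
        rw [List.map_append]
        gcongr
        have := totalCount_append k p (u.map coinStep) (v.map coinStep)
        omega
    _ = _ := by
        rw [← Real.exp_add]
        congr 1
        ring

/-! ### Word length -/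

section wordLength

variable {G : Type*} [Group G] {S : Set G}

theorem wordLength_prod_le {w : List G} (hw : ∀ x ∈ w, x ∈ S ∨ x⁻¹ ∈ S) :
    wordLength S w.prod ≤ w.length :=
  Nat.sInf_le ⟨w, rfl, hw, rfl⟩

/-- Membership in the closure excludes the default value `sInf ∅ = 0`. -/
theorem exists_word_length_eq {g : G} (hg : g ∈ Subgroup.closure S) :
    ∃ w : List G, w.length = wordLength S g ∧ (∀ x ∈ w, x ∈ S ∨ x⁻¹ ∈ S) ∧ w.prod = g := by
  have hne : {n | ∃ w : List G, w.length = n ∧ (∀ x ∈ w, x ∈ S ∨ x⁻¹ ∈ S) ∧ w.prod = g}.Nonempty := by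
    rw [← Subgroup.mem_toSubmonoid, Subgroup.closure_toSubmonoid] at hg
    obtain ⟨w, hw, rfl⟩ := Submonoid.exists_list_of_mem_closure hg
    exact ⟨_, w, rfl, hw, rfl⟩
  exact Nat.sInf_mem hne

theorem wordLength_one : wordLength S (1 : G) = 0 :=
  Nat.le_zero.mp (wordLength_prod_le (w := []) (by simp))

theorem wordLength_le_one {g : G} (hg : g ∈ S ∨ g⁻¹ ∈ S) : wordLength S g ≤ 1 := by
  simpa using wordLength_prod_le (w := [g]) (by simpa using hg)

theorem eq_one_of_wordLength_eq_zero {g : G} (hg : g ∈ Subgroup.closure S)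
    (h : wordLength S g = 0) : g = 1 := by
  obtain ⟨w, hw, -, rfl⟩ := exists_word_length_eq hg
  rw [h, List.length_eq_zero_iff] at hw
  simp [hw]

theorem wordLength_mul_le {g h : G} (hg : g ∈ Subgroup.closure S) (hh : h ∈ Subgroup.closure S) :
    wordLength S (g * h) ≤ wordLength S g + wordLength S h := by
  obtain ⟨u, hu, hu', rfl⟩ := exists_word_length_eq hg
  obtain ⟨v, hv, hv', rfl⟩ := exists_word_length_eq hh
  rw [← hu, ← hv, ← List.prod_append, ← List.length_append]
  refine wordLength_prod_le fun x hx => ?_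
  rcases List.mem_append.mp hx with hx | hx
  · exact hu' x hx
  · exact hv' x hx

theorem wordLength_inv_le {g : G} (hg : g ∈ Subgroup.closure S) :
    wordLength S g⁻¹ ≤ wordLength S g := by
  obtain ⟨u, hu, hu', rfl⟩ := exists_word_length_eq hg
  rw [← hu, List.prod_inv_reverse]
  refine (wordLength_prod_le fun x hx => ?_).trans (by simp)
  obtain ⟨y, hy, rfl⟩ := List.mem_map.mp (List.mem_reverse.mp hx)
  simpa [or_comm] using hu' y hy

theorem wordLength_le_groupDiam [Fintype G] (g : G) : wordLength S g ≤ groupDiam S :=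
  Finset.le_sup (f := fun g : G => wordLength S g) (Finset.mem_univ g)

end wordLength

/-! ### Random products of letters in a lamp group -/

section patternAvg

variable {A B G : Type*} [Group A] [Fintype A] [Group B] [Fintype B] [Group G]
  (a : A →* G) (b : B →* G)

/-- Average of `φ (g * s)` over the letters `s` of a given type. -/
noncomputable def letterAvg : Bool → (G → ℝ) → G → ℝ
  | true, φ, g => (∑ i : A, φ (g * a i)) / Fintype.card A
  | false, φ, g => (∑ i : B, φ (g * b i)) / Fintype.card B

/-- Average of `φ (g * s)` over the products `s` of letters of the given types. -/
noncomputable def patternAvg : List Bool → (G → ℝ) → G → ℝ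
  | [], φ => φ
  | c :: w, φ => letterAvg a b c (patternAvg w φ)

theorem patternAvg_append (u v : List Bool) (φ : G → ℝ) :
    patternAvg a b (u ++ v) φ = patternAvg a b u (patternAvg a b v φ) := by
  induction u with
  | nil => rfl
  | cons c u ih => simp [patternAvg, ih]

/-- The uniform distribution on a finite group is idempotent under convolution. This is what merges
neighbouring letters of one type. -/
theorem letterAvg_letterAvg (c : Bool) (φ : G → ℝ) :
    letterAvg a b c (letterAvg a b c φ) = letterAvg a b c φ := by
  funext g
  cases c
  · simp only [letterAvg, mul_assoc, ← map_mul]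
    have : ∀ i : B, ∑ j : B, φ (g * b (i * j)) = ∑ j : B, φ (g * b j) := fun i =>
      Equiv.sum_comp (Equiv.mulLeft i) fun j => φ (g * b j)
    have h0 : (Fintype.card B : ℝ) ≠ 0 := by simp
    simp only [this, Finset.sum_const, Finset.card_univ, nsmul_eq_mul]
    field_simp
  · simp only [letterAvg, mul_assoc, ← map_mul]
    have : ∀ i : A, ∑ j : A, φ (g * a (i * j)) = ∑ j : A, φ (g * a j) := fun i =>
      Equiv.sum_comp (Equiv.mulLeft i) fun j => φ (g * a j)
    have h0 : (Fintype.card A : ℝ) ≠ 0 := by simp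
    simp only [this, Finset.sum_const, Finset.card_univ, nsmul_eq_mul]
    field_simp

theorem letterAvg_mono (c : Bool) {φ ψ : G → ℝ} {g : G}
    (h : ∀ s, s ∈ lampGens a b → φ (g * s) ≤ ψ (g * s)) :
    letterAvg a b c φ g ≤ letterAvg a b c ψ g := by
  cases c <;> simp only [letterAvg] <;> gcongr with i
  · exact h _ (Or.inr ⟨i, rfl⟩)
  · exact h _ (Or.inl ⟨i, rfl⟩)

theorem patternAvg_mono {φ ψ : G → ℝ} (h : ∀ g, φ g ≤ ψ g) (w : List Bool) (g : G) :
    patternAvg a b w φ g ≤ patternAvg a b w ψ g := by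
  induction w generalizing g with
  | nil => exact h g
  | cons c w ih => exact letterAvg_mono a b c fun s _ => ih _

theorem patternAvg_const (c : ℝ) (w : List Bool) (g : G) :
    patternAvg a b w (fun _ => c) g = c := by
  induction w generalizing g with
  | nil => rfl
  | cons d w ih =>
    have h0 : (Fintype.card A : ℝ) ≠ 0 := by simp
    have h1 : (Fintype.card B : ℝ) ≠ 0 := by simp
    cases d <;> simp only [patternAvg, letterAvg, ih, Finset.sum_const, Finset.card_univ,
      nsmul_eq_mul] <;> field_simp

theorem patternAvg_add (φ ψ : G → ℝ) (w : List Bool) (g : G) :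
    patternAvg a b w (fun x => φ x + ψ x) g = patternAvg a b w φ g + patternAvg a b w ψ g := by
  induction w generalizing g with
  | nil => rfl
  | cons d w ih =>
    cases d <;> simp only [patternAvg, letterAvg, ih, Finset.sum_add_distrib, add_div]

theorem patternAvg_mul_left (c : ℝ) (φ : G → ℝ) (w : List Bool) (g : G) :
    patternAvg a b w (fun x => c * φ x) g = c * patternAvg a b w φ g := by
  induction w generalizing g with
  | nil => rfl
  | cons d w ih =>
    cases d <;> simp only [patternAvg, letterAvg, ih, ← Finset.mul_sum, mul_div_assoc]

theorem patternAvg_sum {ι : Type*} (s : Finset ι) (φ : ι → G → ℝ) (w : List Bool) (g : G) :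
    patternAvg a b w (fun x => ∑ i ∈ s, φ i x) g = ∑ i ∈ s, patternAvg a b w (φ i) g := by
  classical
  induction s using Finset.induction_on with
  | empty => simpa using patternAvg_const a b 0 w g
  | insert i s hi ih => simp only [Finset.sum_insert hi, patternAvg_add, ih]

theorem patternAvg_mul (h : G) (φ : G → ℝ) (w : List Bool) (g : G) :
    patternAvg a b w φ (h * g) = patternAvg a b w (fun x => φ (h * x)) g := by
  induction w generalizing g with
  | nil => rfl
  | cons d w ih => cases d <;> simp only [patternAvg, letterAvg, mul_assoc, ih]

theorem le_patternAvg {c : ℝ} {φ : G → ℝ} (h : ∀ g, c ≤ φ g) (w : List Bool) (g : G) :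
    c ≤ patternAvg a b w φ g := by
  rw [← patternAvg_const a b c w g]
  exact patternAvg_mono a b h w g

/-- Uniform letters are invariant under inversion, so the inverse of a random product follows the
reversed pattern. The factor `h` collects the letters already removed in the induction. -/
theorem patternAvg_reverse (ψ : G → ℝ) (w : List Bool) (h : G) :
    patternAvg a b w (fun x => ψ (x⁻¹ * h)) 1 = patternAvg a b w.reverse (fun x => ψ (x * h)) 1 := by
  induction w generalizing h with
  | nil => simp [patternAvg]
  | cons d w ih =>
    rw [List.reverse_cons, patternAvg_append]
    have key : ∀ s : G, patternAvg a b w (fun x => ψ (x⁻¹ * h)) (1 * s) =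
        patternAvg a b w.reverse (fun x => ψ (x * (s⁻¹ * h))) 1 := by
      intro s
      rw [one_mul, ← ih (s⁻¹ * h)]
      conv_lhs => rw [← mul_one s, patternAvg_mul]
      simp only [mul_inv_rev, mul_assoc]
    cases d
    · have : letterAvg a b false (fun x => ψ (x * h)) =
          fun x => (Fintype.card B : ℝ)⁻¹ * ∑ i : B, ψ (x * (b i * h)) := by
        funext x
        simp only [letterAvg, div_eq_inv_mul, mul_assoc]
      simp only [patternAvg]
      rw [this, patternAvg_mul_left, patternAvg_sum]
      simp only [letterAvg, key, div_eq_inv_mul]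
      rw [← Equiv.sum_comp (Equiv.inv B)]
      simp
    · have : letterAvg a b true (fun x => ψ (x * h)) =
          fun x => (Fintype.card A : ℝ)⁻¹ * ∑ i : A, ψ (x * (a i * h)) := by
        funext x
        simp only [letterAvg, div_eq_inv_mul, mul_assoc]
      simp only [patternAvg]
      rw [this, patternAvg_mul_left, patternAvg_sum]
      simp only [letterAvg, key, div_eq_inv_mul]
      rw [← Equiv.sum_comp (Equiv.inv A)]
      simp

theorem sum_patternAvg [Fintype G] (φ : G → ℝ) (w : List Bool) :
    ∑ g : G, patternAvg a b w φ g = ∑ g : G, φ g := by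
  induction w with
  | nil => rfl
  | cons d w ih =>
    have h0 : (Fintype.card A : ℝ) ≠ 0 := by simp
    have h1 : (Fintype.card B : ℝ) ≠ 0 := by simp
    have : ∀ s : G, ∑ g : G, patternAvg a b w φ (g * s) = ∑ g : G, φ g := fun s => by
      rw [← ih]
      exact Equiv.sum_comp (Equiv.mulRight s) (patternAvg a b w φ)
    cases d
    · simp only [patternAvg, letterAvg]
      rw [← Finset.sum_div, Finset.sum_comm]
      simp only [this, Finset.sum_const, Finset.card_univ, nsmul_eq_mul]
      field_simp
    · simp only [patternAvg, letterAvg]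
      rw [← Finset.sum_div, Finset.sum_comm]
      simp only [this, Finset.sum_const, Finset.card_univ, nsmul_eq_mul]
      field_simp

/-- Each letter changes the word length by at most `1`, so only a ball around `g` is reached. -/
theorem patternAvg_mono_of_le (hS : Subgroup.closure (lampGens a b) = ⊤) {φ ψ : G → ℝ}
    (w : List Bool) (g : G)
    (h : ∀ x, wordLength (lampGens a b) x ≤ wordLength (lampGens a b) g + w.length → φ x ≤ ψ x) :
    patternAvg a b w φ g ≤ patternAvg a b w ψ g := by
  induction w generalizing g with
  | nil => exact h g (by simp)
  | cons c w ih =>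
    refine letterAvg_mono a b c fun s hs => ih _ fun x hx => h x ?_
    have h1 := wordLength_mul_le (S := lampGens a b) (g := g) (h := s) (by simp [hS]) (by simp [hS])
    have h2 := wordLength_le_one (S := lampGens a b) (Or.inl hs)
    simp only [List.length_cons]
    omega

/-! ### Normal form of patterns -/

/-- The pattern `B A B A … B A`. -/
def altPattern : ℕ → List Bool
  | 0 => []
  | c + 1 => false :: true :: altPattern c

/-- The pattern `(A B A)(A B A) … (A B A)`. -/
def stepPattern : ℕ → List Bool
  | 0 => []
  | c + 1 => true :: false :: true :: stepPattern c

theorem length_altPattern (c : ℕ) : (altPattern c).length = 2 * c := by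
  induction c with
  | zero => rfl
  | succ c ih => simp [altPattern, ih]; ring

theorem stepPattern_add (s t : ℕ) : stepPattern (s + t) = stepPattern s ++ stepPattern t := by
  induction s with
  | zero => simp [stepPattern]
  | succ s ih => simp [stepPattern, Nat.succ_add, ih]

theorem reverse_stepPattern (t : ℕ) : (stepPattern t).reverse = stepPattern t := by
  induction t with
  | zero => rfl
  | succ t ih =>
    simp only [stepPattern, List.reverse_cons, ih]
    have := stepPattern_add t 1
    rw [Nat.add_comm] at this
    simp [stepPattern] at this ⊢
    rw [← this, Nat.add_comm]
    simp [stepPattern]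

/-- The adjacent `A`-letters of consecutive steps `ABA` merge. -/
theorem patternAvg_stepPattern {c : ℕ} (hc : c ≠ 0) (φ : G → ℝ) :
    patternAvg a b (stepPattern c) φ = patternAvg a b (true :: altPattern c) φ := by
  induction c with
  | zero => exact absurd rfl hc
  | succ c ih =>
    rcases c with _ | c
    · rfl
    · have := ih (Nat.succ_ne_zero c)
      simp only [stepPattern, altPattern, patternAvg] at this ⊢
      rw [this, letterAvg_letterAvg]

theorem patternAvg_cons_normal (w : List Bool) :
    (∃ t, (t = [] ∨ t = [false]) ∧ ∀ φ : G → ℝ, patternAvg a b (true :: w) φ =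
      patternAvg a b (true :: (altPattern (altCount true w) ++ t)) φ) ∧
    (∃ t, (t = [] ∨ t = [false]) ∧ ∀ φ : G → ℝ, patternAvg a b (false :: w) φ =
      patternAvg a b (altPattern (altCount false w) ++ t) φ) := by
  induction w with
  | nil => exact ⟨⟨[], by simp, fun φ => rfl⟩, ⟨[false], by simp, fun φ => rfl⟩⟩
  | cons c w ih =>
    obtain ⟨⟨t, ht, h⟩, ⟨t', ht', h'⟩⟩ := ih
    cases c
    · refine ⟨⟨t', ht', fun φ => ?_⟩, ⟨t', ht', fun φ => ?_⟩⟩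
      · rw [patternAvg, h']
        rfl
      · rw [altCount, ← h']
        simp only [patternAvg, letterAvg_letterAvg]
    · refine ⟨⟨t, ht, fun φ => ?_⟩, ⟨t, ht, fun φ => ?_⟩⟩
      · rw [altCount, ← h]
        simp only [patternAvg, letterAvg_letterAvg]
      · rw [patternAvg, h]
        rfl

/-- Once equal neighbours have merged, the pattern alternates strictly; a `B` may be left over
before the first `A` and after the last one. -/
theorem patternAvg_normal {w : List Bool} (hw : excCount w ≠ 0) :
    ∃ h t, (h = [] ∨ h = [false]) ∧ (t = [] ∨ t = [false]) ∧ ∀ φ : G → ℝ, patternAvg a b w φ =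
      patternAvg a b (h ++ (true :: (altPattern (excCount w) ++ t))) φ := by
  induction w with
  | nil => exact absurd rfl hw
  | cons c w ih =>
    cases c
    · obtain ⟨h, t, hh, ht, H⟩ := ih hw
      refine ⟨[false], t, Or.inr rfl, ht, fun φ => ?_⟩
      rw [patternAvg, H, excCount]
      rcases hh with rfl | rfl
      · rfl
      · simp only [List.singleton_append, patternAvg, letterAvg_letterAvg]
    · obtain ⟨t, ht, H⟩ := (patternAvg_cons_normal a b w).1
      exact ⟨[], t, Or.inl rfl, ht, H⟩

/-! ### Lower bounds for the expected word length -/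

/-- A uniform `A`-letter makes every value of the product have probability at most `1 / |A| ≤ 1 /
2`, in particular the value `1`; any other value has length at least `1`. This covers the sites
where the speed bound is too weak. -/
theorem half_le_patternAvg [Fintype G] (ha : Function.Injective a) (hA : 2 ≤ Fintype.card A)
    (hS : Subgroup.closure (lampGens a b) = ⊤) {w : List Bool} (hw : true ∈ w) (g : G) :
    1 / 2 ≤ patternAvg a b w (fun x => (wordLength (lampGens a b) x : ℝ)) g := by
  classical
  obtain ⟨u, v, rfl⟩ := List.append_of_mem hw
  have h1 : ∀ g, patternAvg a b (true :: v) (fun x => if x = 1 then (1 : ℝ) else 0) g ≤ 1 / 2 := by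
    intro g
    have hnn : ∀ x, 0 ≤ patternAvg a b v (fun x => if x = 1 then (1 : ℝ) else 0) x :=
      le_patternAvg a b (fun x => by split_ifs <;> norm_num) v
    have hinj : Function.Injective fun i => g * a i := fun i j h => ha (mul_left_cancel h)
    have hA' : (2 : ℝ) ≤ Fintype.card A := by exact_mod_cast hA
    simp only [patternAvg, letterAvg]
    rw [div_le_div_iff₀ (by linarith) (by norm_num)]
    -- The points `g * a i` are distinct, so the sum is at most the sum over all of `G`, which is
    -- `1` by `sum_patternAvg`.
    have : ∑ i : A, patternAvg a b v (fun x => if x = 1 then (1 : ℝ) else 0) (g * a i) ≤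
        ∑ x : G, patternAvg a b v (fun x => if x = 1 then (1 : ℝ) else 0) x := by
      rw [← Finset.sum_image (s := Finset.univ) (g := fun i => g * a i)
        (f := patternAvg a b v (fun x => if x = 1 then (1 : ℝ) else 0)) (fun i _ j _ h => hinj h)]
      exact Finset.sum_le_sum_of_subset_of_nonneg (Finset.subset_univ _) fun x _ _ => hnn x
    rw [sum_patternAvg] at this
    simp only [Finset.sum_ite_eq', Finset.mem_univ, if_true] at this
    linarith
  rw [patternAvg_append]
  refine le_patternAvg a b (fun g => ?_) u g
  calc (1 : ℝ) / 2 ≤ 1 + (-1) * patternAvg a b (true :: v) (fun x => if x = 1 then (1 : ℝ) else 0) g := by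
        linarith [h1 g]
    _ = patternAvg a b (true :: v) (fun x => 1 + (-1) * if x = 1 then (1 : ℝ) else 0) g := by
        rw [patternAvg_add, patternAvg_mul_left, patternAvg_const]
    _ ≤ _ := by
        refine patternAvg_mono a b (fun x => ?_) _ g
        split_ifs with hx
        · simp
        · have : wordLength (lampGens a b) x ≠ 0 := fun h =>
            hx (eq_one_of_wordLength_eq_zero (by simp [hS]) h)
          have : (1 : ℝ) ≤ wordLength (lampGens a b) x := by
            exact_mod_cast Nat.one_le_iff_ne_zero.mpr this
          linarith

/-- For independent copies `X`, `Y` of the walk after `r` steps, `X⁻¹ * Y` has the law of the walk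
after `2 * r` steps, since the step pattern is a palindrome. Its length is at most `|g * X| + |g *
Y|`. This gives a lower bound from an arbitrary starting point `g`. -/
theorem patternAvg_stepPattern_two_mul_le (hS : Subgroup.closure (lampGens a b) = ⊤) (r : ℕ)
    (g : G) :
    patternAvg a b (stepPattern (2 * r)) (fun x => (wordLength (lampGens a b) x : ℝ)) 1 ≤
      2 * patternAvg a b (stepPattern r) (fun x => (wordLength (lampGens a b) x : ℝ)) g := by
  set ℓ : G → ℝ := fun x => (wordLength (lampGens a b) x : ℝ) with hℓ
  set w := stepPattern r with hw
  have hg : patternAvg a b w ℓ g = patternAvg a b w (fun x => ℓ (g * x)) 1 := by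
    rw [← patternAvg_mul, mul_one]
  have h1 : patternAvg a b (stepPattern (2 * r)) ℓ 1 =
      patternAvg a b w (fun x => patternAvg a b w (fun y => ℓ (x⁻¹ * y)) 1) 1 := by
    have := patternAvg_reverse a b (patternAvg a b w ℓ) w 1
    simp only [mul_one, hw, reverse_stepPattern] at this
    rw [two_mul, stepPattern_add, patternAvg_append, ← this]
    simp only [← patternAvg_mul, mul_one, hw]
  have h2 : ∀ x y, ℓ (x⁻¹ * y) ≤ ℓ (g * x) + ℓ (g * y) := by
    intro x y
    have e : x⁻¹ * y = (g * x)⁻¹ * (g * y) := by group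
    have hmem : ∀ z : G, z ∈ Subgroup.closure (lampGens a b) := by simp [hS]
    have i1 := wordLength_mul_le (hmem (g * x)⁻¹) (hmem (g * y))
    have i2 := wordLength_inv_le (hmem (g * x))
    rw [← e] at i1
    simp only [hℓ]
    exact_mod_cast i1.trans (Nat.add_le_add_right i2 _)
  rw [h1, hg]
  calc _ ≤ patternAvg a b w (fun x => ℓ (g * x) + patternAvg a b w (fun y => ℓ (g * y)) 1) 1 := by
        refine patternAvg_mono a b (fun x => ?_) w 1
        calc _ ≤ patternAvg a b w (fun y => ℓ (g * x) + ℓ (g * y)) 1 :=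
              patternAvg_mono a b (h2 x) w 1
          _ = _ := by rw [patternAvg_add, patternAvg_const]
    _ = _ := by
        rw [patternAvg_add, patternAvg_const]
        ring

/-- The expected length at a site with `c` alternations. -/
theorem le_patternAvg_wordLength [Fintype G] (ha : Function.Injective a)
    (hA : 2 ≤ Fintype.card A) (hS : Subgroup.closure (lampGens a b) = ⊤) {σ T : ℝ} (hσ : 0 ≤ σ)
    (hσ3 : σ ≤ 3) (hT0 : 0 ≤ T)
    (hT : ∀ t : ℕ, (t : ℝ) ≤ T → σ * t ≤
      patternAvg a b (stepPattern t) (fun x => (wordLength (lampGens a b) x : ℝ)) 1)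
    {w : List Bool} (hw : excCount w ≠ 0) :
    σ / 12 * min (excCount w : ℝ) T ≤
      patternAvg a b w (fun x => (wordLength (lampGens a b) x : ℝ)) 1 := by
  set ℓ : G → ℝ := fun x => (wordLength (lampGens a b) x : ℝ) with hℓ
  obtain ⟨h, t, -, ht, H⟩ := patternAvg_normal a b hw
  set c := excCount w with hc
  have hhalf : 1 / 2 ≤ patternAvg a b w ℓ 1 := by
    rw [H]
    exact half_le_patternAvg a b ha hA hS (by simp) 1
  -- Only the last `r` steps are used; all earlier letters act as an arbitrary starting point, and a
  -- final `B`-letter costs at most `1`.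
  have hr : ∀ r ≤ c, patternAvg a b (stepPattern (2 * r)) ℓ 1 / 2 - 1 ≤ patternAvg a b w ℓ 1 := by
    intro r hr
    have e : patternAvg a b w ℓ 1 =
        patternAvg a b (h ++ stepPattern (c - r)) (patternAvg a b (stepPattern r)
          (patternAvg a b t ℓ)) 1 := by
      rw [H, patternAvg_append, patternAvg_append, ← patternAvg_append a b (stepPattern (c - r)),
        ← stepPattern_add, Nat.sub_add_cancel hr, patternAvg_stepPattern a b hw,
        ← List.cons_append, patternAvg_append a b (true :: _)]
    rw [e]
    refine le_patternAvg a b (fun g => ?_) _ 1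
    have h1 := patternAvg_stepPattern_two_mul_le a b hS r g
    have h2 : patternAvg a b (stepPattern r) ℓ g + (-1) ≤
        patternAvg a b (stepPattern r) (patternAvg a b t ℓ) g := by
      rw [← patternAvg_const a b (-1) (stepPattern r) g, ← patternAvg_add]
      refine patternAvg_mono a b (fun x => ?_) _ g
      rcases ht with rfl | rfl
      · simp [patternAvg]
      · rw [← patternAvg_const a b (ℓ x + -1) [false] x]
        refine letterAvg_mono a b false fun s hs => ?_
        have hmem : ∀ z : G, z ∈ Subgroup.closure (lampGens a b) := by simp [hS]
        have i1 := wordLength_mul_le (hmem (x * s)) (hmem s⁻¹)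
        rw [mul_inv_cancel_right] at i1
        have i2 := wordLength_le_one (S := lampGens a b) (g := s⁻¹) (Or.inr (by simpa using hs))
        have : wordLength (lampGens a b) x ≤ wordLength (lampGens a b) (x * s) + 1 := by omega
        simp only [patternAvg, hℓ]
        have : (wordLength (lampGens a b) x : ℝ) ≤ wordLength (lampGens a b) (x * s) + 1 := by
          exact_mod_cast this
        linarith
    linarith
  set f := ⌊T⌋₊ with hf
  -- The comparison doubles the number of steps, so the speed bound is needed at `2 * r ≤ T`;
  -- rounding loses at most `2`.
  set r := min c f / 2 with hrdef
  have hrc : r ≤ c := by omega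
  have h2r : ((2 * r : ℕ) : ℝ) ≤ T :=
    (Nat.cast_le.mpr (by omega : 2 * r ≤ f)).trans (Nat.floor_le hT0)
  have hlow := hr r hrc
  have hsp := hT (2 * r) h2r
  have hM : min (c : ℝ) T ≤ 2 * r + 2 := by
    have h1 : T ≤ f + 1 := (Nat.lt_floor_add_one T).le
    have h2 : min c (f + 1) ≤ 2 * r + 2 := by omega
    have h3 : min (c : ℝ) (f + 1) ≤ 2 * r + 2 := by exact_mod_cast h2
    exact (min_le_min_left _ h1).trans h3
  have hM' : σ / 12 * min (c : ℝ) T ≤ σ / 12 * (2 * r + 2) := by gcongr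
  refine hM'.trans ?_
  push_cast at hsp
  rcases Nat.eq_zero_or_pos r with h0 | h0
  · rw [h0]
    norm_num
    linarith
  · have h0' : (1 : ℝ) ≤ r := by exact_mod_cast h0
    have hu : σ * 1 ≤ σ * r := by gcongr
    -- For `σ * r ≤ 3 / 2` the bound `1 / 2` suffices, otherwise `σ * r - 1` does; both use `r + 1 ≤
    -- 2 * r`.
    rcases le_total (σ * r) (3 / 2) with h | h <;> nlinarith

end patternAvg

/-! ### The speed as an average over patterns -/

section speed

variable {G : Type*} [Group G] [Fintype G]

/-- Expectation of a function on a finite group. -/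
noncomputable def pmfMean {G : Type*} [Fintype G] (p : PMF G) (φ : G → ℝ) : ℝ := ∑ g : G, (p g).toReal * φ g

theorem pmfMean_bind {G H : Type*} [Fintype G] [Fintype H] (p : PMF G) (f : G → PMF H) (φ : H → ℝ) :
    pmfMean (p.bind f) φ = pmfMean p fun x => pmfMean (f x) φ := by
  simp only [pmfMean, PMF.bind_apply, tsum_fintype, Finset.mul_sum]
  rw [Finset.sum_comm]
  refine Finset.sum_congr rfl fun h _ => ?_
  rw [ENNReal.toReal_sum fun g _ => ENNReal.mul_ne_top (PMF.apply_ne_top _ _) (PMF.apply_ne_top _ _),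
    Finset.sum_mul]
  simp only [ENNReal.toReal_mul, mul_assoc]

theorem pmfMean_pure {G : Type*} [Fintype G] (g : G) (φ : G → ℝ) : pmfMean (PMF.pure g) φ = φ g := by
  classical
  simp only [pmfMean, PMF.pure_apply]
  rw [Finset.sum_eq_single g (fun h _ hne => by simp [hne]) (by simp)]
  simp

theorem pmfMean_map {G H : Type*} [Fintype G] [Fintype H] (p : PMF G) (f : G → H) (φ : H → ℝ) :
    pmfMean (p.map f) φ = pmfMean p fun x => φ (f x) := by
  rw [← PMF.bind_pure_comp, pmfMean_bind]
  simp only [Function.comp_apply, pmfMean_pure]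

theorem pmfMean_convolve (p q : PMF G) (φ : G → ℝ) :
    pmfMean (convolve p q) φ = pmfMean p fun x => pmfMean q fun y => φ (x * y) := by
  simp only [convolve, pmfMean_bind, pmfMean_map]

theorem pmfMean_uniformImage {A G : Type*} [Group A] [Fintype A] [Fintype G] (f : A → G) (φ : G → ℝ) :
    pmfMean (uniformImage f) φ = (∑ i : A, φ (f i)) / Fintype.card A := by
  rw [uniformImage, pmfMean_map]
  simp only [pmfMean, PMF.uniformOfFintype_apply, ENNReal.toReal_inv, ENNReal.toReal_natCast]
  rw [← Finset.mul_sum, div_eq_inv_mul]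

variable {A B : Type*} [Group A] [Fintype A] [Group B] [Fintype B] (a : A →* G) (b : B →* G)

theorem pmfMean_lampStep (φ : G → ℝ) (g : G) :
    pmfMean (lampStep a b) (fun x => φ (g * x)) = patternAvg a b [true, false, true] φ g := by
  simp only [lampStep, pmfMean_convolve, pmfMean_uniformImage, patternAvg, letterAvg, mul_assoc]

theorem pmfMean_convolvePow_lampStep (t : ℕ) (φ : G → ℝ) :
    pmfMean (convolvePow (lampStep a b) t) φ = patternAvg a b (stepPattern t) φ 1 := by
  induction t generalizing φ with
  | zero => exact pmfMean_pure _ _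
  | succ t ih =>
    rw [convolvePow, pmfMean_convolve]
    simp only [pmfMean_lampStep]
    rw [ih, stepPattern_add, patternAvg_append]
    rfl

theorem lampSpeed_eq (t : ℕ) :
    lampSpeed a b t =
      patternAvg a b (stepPattern t) (fun x => (wordLength (lampGens a b) x : ℝ)) 1 :=
  pmfMean_convolvePow_lampStep a b t _

theorem lampSpeed_one_le (hS : Subgroup.closure (lampGens a b) = ⊤) : lampSpeed a b 1 ≤ 3 := by
  rw [lampSpeed_eq, ← patternAvg_const a b 3 (stepPattern 1) 1]
  refine patternAvg_mono_of_le a b hS _ _ fun x hx => ?_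
  rw [wordLength_one] at hx
  have : wordLength (lampGens a b) x ≤ 3 := by simpa [stepPattern] using hx
  exact_mod_cast this

end speed

/-! ### Steps in `Γ ≀ ℤ` -/

section layerStep

variable {A B G : Type*} [Group A] [Group B] [Group G] (a : A →* G) (b : B →* G)

/-- The element of `Γ ≀ ℤ` that corresponds to one step of the switch-walk-switch walk. -/
noncomputable def layerStep (k : ℕ) (ξ : Bool × ((A × B) × (A × B))) : Lamplighter G :=
  layerGen a b k (.alpha ξ.2.1.1) * layerGen a b k (.beta ξ.2.1.2) *
    (if ξ.1 then layerGen a b k .tau else (layerGen a b k .tau)⁻¹) *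
    (layerGen a b k (.alpha ξ.2.2.1) * layerGen a b k (.beta ξ.2.2.2))

theorem mul_single_lamp (g : Lamplighter G) (y : ℤ) (γ : G) :
    (g * Lamplighter.single y γ).lamp =
      Function.update g.lamp (g.pos + y) (g.lamp (g.pos + y) * γ) := by
  funext x
  rw [Lamplighter.mul_lamp]
  simp only [Lamplighter.single]
  by_cases h : x = g.pos + y
  · subst h
    simp
  · rw [Function.update_of_ne h, Pi.mulSingle_eq_of_ne (by omega), mul_one]

theorem mul_single_pos (g : Lamplighter G) (y : ℤ) (γ : G) :
    (g * Lamplighter.single y γ).pos = g.pos := by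
  simp [Lamplighter.mul_pos', Lamplighter.single]

theorem mul_shift_lamp (g : Lamplighter G) : (g * Lamplighter.shift).lamp = g.lamp := by
  funext x
  simp [Lamplighter.mul_lamp, Lamplighter.shift]

theorem mul_shift_inv_lamp (g : Lamplighter G) : (g * (Lamplighter.shift)⁻¹).lamp = g.lamp := by
  funext x
  simp [Lamplighter.mul_lamp, Lamplighter.inv_lamp, Lamplighter.shift]

theorem mul_walk_lamp (k : ℕ) (g : Lamplighter G) (e : Bool) :
    (g * (if e then layerGen a b k .tau else (layerGen a b k .tau)⁻¹)).lamp = g.lamp := by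
  cases e
  · exact mul_shift_inv_lamp g
  · exact mul_shift_lamp g

theorem mul_walk_pos (k : ℕ) (g : Lamplighter G) (e : Bool) :
    (g * (if e then layerGen a b k .tau else (layerGen a b k .tau)⁻¹)).pos =
      g.pos + coinStep e := by
  cases e
  · simp [Lamplighter.mul_pos', layerGen, Lamplighter.inv_pos, Lamplighter.shift, coinStep]
  · simp [Lamplighter.mul_pos', layerGen, Lamplighter.shift, coinStep]

theorem mul_layerStep_pos (k : ℕ) (g : Lamplighter G) (ξ : Bool × ((A × B) × (A × B))) :
    (g * layerStep a b k ξ).pos = g.pos + coinStep ξ.1 := by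
  simp only [layerStep, ← mul_assoc]
  simp only [layerGen]
  rw [mul_single_pos, mul_single_pos]
  have := mul_walk_pos a b k (g * Lamplighter.single 0 (a ξ.2.1.1) *
    Lamplighter.single k (b ξ.2.1.2)) ξ.1
  simp only [layerGen] at this
  rw [this, mul_single_pos, mul_single_pos]

/-! ### Word length in `Γ ≀ ℤ` -/

/-- Multiplying on the right by a generator or its inverse changes at most one lamp, and that one by
a single letter. -/
theorem sum_wordLength_lamp_le_length (k : ℕ) (hS : Subgroup.closure (lampGens a b) = ⊤)
    (X : Finset ℤ) (w : List (Lamplighter G))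
    (hw : ∀ x ∈ w, x ∈ Set.range (layerGen a b k) ∨ x⁻¹ ∈ Set.range (layerGen a b k)) :
    ∑ x ∈ X, wordLength (lampGens a b) (w.prod.lamp x) ≤ w.length := by
  induction w using List.reverseRecOn with
  | nil =>
    have : ∀ x, (1 : Lamplighter G).lamp x = 1 := fun _ => rfl
    simp [this, wordLength_one]
  | append_singleton w s ih =>
    have ih' := ih fun x hx => hw x (by simp [hx])
    rw [List.prod_append, List.prod_singleton, List.length_append, List.length_singleton]
    set g := w.prod
    have key : g.lamp = (g * s).lamp ∨ ∃ y γ, (γ ∈ lampGens a b ∨ γ⁻¹ ∈ lampGens a b) ∧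
        (g * s).lamp = Function.update g.lamp y (g.lamp y * γ) := by
      have hinv : ∀ (y : ℤ) (γ : G), (Lamplighter.single y γ)⁻¹ = Lamplighter.single y γ⁻¹ := by
        intro y γ
        rw [inv_eq_iff_mul_eq_one]
        ext x
        · rw [mul_single_lamp]
          by_cases hx : x = y
          · subst hx
            simp [Lamplighter.single, Lamplighter.one_lamp]
          · simp [Lamplighter.single, Lamplighter.one_lamp, hx]
        · rw [mul_single_pos]
          rfl
      rcases hw s (by simp) with ⟨j, hj⟩ | ⟨j, hj⟩
      · rcases j with _ | i | i
        · left
          rw [← hj]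
          exact (mul_shift_lamp g).symm
        · right
          rw [← hj]
          exact ⟨_, _, Or.inl (Or.inl ⟨i, rfl⟩), mul_single_lamp g _ _⟩
        · right
          rw [← hj]
          exact ⟨_, _, Or.inl (Or.inr ⟨i, rfl⟩), mul_single_lamp g _ _⟩
      · rw [eq_comm, inv_eq_iff_eq_inv] at hj
        rcases j with _ | i | i
        · left
          rw [hj]
          exact (mul_shift_inv_lamp g).symm
        · right
          rw [hj]
          simp only [layerGen, hinv]
          exact ⟨_, _, Or.inr (Or.inl ⟨i, (inv_inv _).symm⟩), mul_single_lamp g _ _⟩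
        · right
          rw [hj]
          simp only [layerGen, hinv]
          exact ⟨_, _, Or.inr (Or.inr ⟨i, (inv_inv _).symm⟩), mul_single_lamp g _ _⟩
    rcases key with h | ⟨y, γ, hγ, h⟩
    · rw [← h]
      omega
    · rw [h]
      have hle : ∀ x ∈ X, wordLength (lampGens a b) (Function.update g.lamp y (g.lamp y * γ) x) ≤
          wordLength (lampGens a b) (g.lamp x) + if x = y then 1 else 0 := by
        intro x _
        by_cases hx : x = y
        · subst hx
          rw [Function.update_self, if_pos rfl]
          have h1 := wordLength_mul_le (S := lampGens a b) (g := g.lamp x) (h := γ)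
            (by simp [hS]) (by simp [hS])
          have h2 := wordLength_le_one hγ
          omega
        · rw [Function.update_of_ne hx, if_neg hx, add_zero]
      refine (Finset.sum_le_sum hle).trans ?_
      rw [Finset.sum_add_distrib]
      have : ∑ x ∈ X, (if x = y then 1 else 0) ≤ 1 := by
        rw [Finset.sum_ite_eq' X y]
        split_ifs <;> omega
      omega

theorem sum_wordLength_lamp_le (k : ℕ) (hS : Subgroup.closure (lampGens a b) = ⊤)
    (X : Finset ℤ) {g : Lamplighter G} (hg : g ∈ Subgroup.closure (Set.range (layerGen a b k))) :
    ∑ x ∈ X, wordLength (lampGens a b) (g.lamp x) ≤ layerLength a b k g := by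
  obtain ⟨w, hw, hw', rfl⟩ := exists_word_length_eq hg
  rw [layerLength, ← hw]
  exact sum_wordLength_lamp_le_length a b k hS X w hw'

end layerStep

/-! ### Random lamp configurations -/

section lampAvg

variable {A B G : Type*} [Group A] [Fintype A] [Group B] [Fintype B] [Group G]
  (a : A →* G) (b : B →* G)

/-- The average of `F` over the lamp configurations obtained from `f` by a sequence of switches
with uniform letters. -/
noncomputable def lampAvg : List (ℤ × Bool) → ((ℤ → G) → ℝ) → (ℤ → G) → ℝ
  | [], F, f => F f
  | q :: w, F, f => letterAvg a b q.2 (fun s => lampAvg w F (Function.update f q.1 s)) (f q.1)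

/-- The lamps at different sites are independent. -/
theorem lampAvg_prod (X : Finset ℤ) (φ : ℤ → G → ℝ) (w : List (ℤ × Bool)) (f : ℤ → G) :
    lampAvg a b w (fun f => ∏ x ∈ X, φ x (f x)) f =
      ∏ x ∈ X, patternAvg a b (lettersAt x w) (φ x) (f x) := by
  induction w generalizing f with
  | nil => rfl
  | cons q w ih =>
    obtain ⟨y, c⟩ := q
    simp only [lampAvg, ih]
    by_cases hy : y ∈ X
    · have h1 : ∀ s, ∏ x ∈ X, patternAvg a b (lettersAt x w) (φ x) (Function.update f y s x) =
          (∏ x ∈ X.erase y, patternAvg a b (lettersAt x w) (φ x) (f x)) *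
            patternAvg a b (lettersAt y w) (φ y) s := by
        intro s
        rw [← Finset.prod_erase_mul _ _ hy, Function.update_self]
        congr 1
        refine Finset.prod_congr rfl fun x hx => ?_
        rw [Function.update_of_ne (Finset.ne_of_mem_erase hx)]
      simp only [h1]
      rw [← Finset.prod_erase_mul _ _ hy]
      have h2 : ∀ x ∈ X.erase y, lettersAt x ((y, c) :: w) = lettersAt x w := fun x hx => by
        rw [lettersAt, if_neg (Finset.ne_of_mem_erase hx).symm]
      have h4 : ∏ x ∈ X.erase y, patternAvg a b (lettersAt x ((y, c) :: w)) (φ x) (f x) =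
          ∏ x ∈ X.erase y, patternAvg a b (lettersAt x w) (φ x) (f x) :=
        Finset.prod_congr rfl fun x hx => by rw [h2 x hx]
      rw [h4]
      have h3 : lettersAt y ((y, c) :: w) = c :: lettersAt y w := by simp [lettersAt]
      rw [h3]
      exact patternAvg_mul_left a b _ (patternAvg a b (lettersAt y w) (φ y)) [c] (f y)
    · have h1 : ∀ s, ∏ x ∈ X, patternAvg a b (lettersAt x w) (φ x) (Function.update f y s x) =
          ∏ x ∈ X, patternAvg a b (lettersAt x w) (φ x) (f x) := fun s =>
        Finset.prod_congr rfl fun x hx => by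
          rw [Function.update_of_ne (ne_of_mem_of_not_mem hx hy)]
      simp only [h1]
      have h4 : ∏ x ∈ X, patternAvg a b (lettersAt x ((y, c) :: w)) (φ x) (f x) =
          ∏ x ∈ X, patternAvg a b (lettersAt x w) (φ x) (f x) :=
        Finset.prod_congr rfl fun x hx => by
          rw [lettersAt, if_neg (ne_of_mem_of_not_mem hx hy).symm]
      rw [h4]
      exact patternAvg_const a b _ [c] (f y)

theorem lampAvg_step (k : ℕ) (e : Bool) (g : Lamplighter G) (F : (ℤ → G) → ℝ) :
    (∑ y : (A × B) × (A × B), F (g * layerStep a b k (e, y)).lamp) /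
        Fintype.card ((A × B) × (A × B)) =
      lampAvg a b [(g.pos, true), (g.pos + k, false),
        (g.pos + coinStep e, true), (g.pos + coinStep e + k, false)]
        F g.lamp := by
  -- The updates are nested because the four sites may coincide, for instance when `k = 0`.
  have hlamp : ∀ y : (A × B) × (A × B), (g * layerStep a b k (e, y)).lamp =
      let f1 := Function.update g.lamp g.pos (g.lamp g.pos * a y.1.1)
      let f2 := Function.update f1 (g.pos + k) (f1 (g.pos + k) * b y.1.2)
      let p := g.pos + coinStep e
      let f3 := Function.update f2 p (f2 p * a y.2.1)
      Function.update f3 (p + k) (f3 (p + k) * b y.2.2) := by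
    intro y
    have h1 := mul_walk_lamp a b k (g * Lamplighter.single 0 (a y.1.1) *
      Lamplighter.single k (b y.1.2)) e
    have h2 := mul_walk_pos a b k (g * Lamplighter.single 0 (a y.1.1) *
      Lamplighter.single k (b y.1.2)) e
    simp only [layerStep, ← mul_assoc]
    simp only [layerGen] at h1 h2 ⊢
    rw [mul_single_lamp, mul_single_pos, mul_single_lamp, h1, h2, mul_single_lamp,
      mul_single_pos, mul_single_pos, mul_single_lamp]
    simp only [add_zero, mul_single_pos]
  simp only [hlamp, lampAvg, letterAvg, Fintype.sum_prod_type, Fintype.card_prod, Nat.cast_mul]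
  simp only [← Finset.sum_div, div_div]
  congr 1
  ring

/-- Averaging over the letters for a fixed path. -/
theorem wordAvg_layerStep (k : ℕ) (F : (ℤ → G) → ℝ) (e : List Bool) (g : Lamplighter G) :
    wordAvg e.length (fun y : List ((A × B) × (A × B)) =>
        F (g * ((e.zip y).map (layerStep a b k)).prod).lamp) =
      lampAvg a b (switchWord k g.pos (e.map coinStep)) F g.lamp := by
  induction e generalizing g with
  | nil => simp [wordAvg, switchWord, lampAvg]
  | cons c e ih =>
    simp only [List.length_cons, wordAvg, List.zip_cons_cons, List.map_cons, List.prod_cons,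
      ← mul_assoc, ih, mul_layerStep_pos, switchWord]
    rw [lampAvg_step a b k c g (fun f => lampAvg a b (switchWord k
      (g.pos + coinStep c) (e.map coinStep)) F f)]
    rfl

end lampAvg

/-! ### Concentration of the total lamp length for a given path -/

section concentration

variable {A B G : Type*} [Group A] [Fintype A] [Group B] [Fintype B] [Group G] [Fintype G]
  (a : A →* G) (b : B →* G)

theorem exp_neg_le_of_le {z : ℝ} (h0 : 0 ≤ z) (h1 : z ≤ 1 / 8) :
    Real.exp (-z) ≤ 1 - 7 / 8 * z := by
  rw [Real.exp_neg]
  have h2 : 1 + z ≤ Real.exp z := by linarith [Real.add_one_le_exp z]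
  calc (Real.exp z)⁻¹ ≤ (1 + z)⁻¹ := inv_anti₀ (by linarith) h2
    _ ≤ 1 - 7 / 8 * z := by
      rw [inv_le_iff_one_le_mul₀ (by linarith)]
      nlinarith

/-- The length is at most the diameter and at most the number of letters of the normal form; the
pattern `w` itself may be much longer. With the exponent `1 / (8 * D)`, replacing the exponential by
a linear function loses only the factor `7 / 8`. -/
theorem patternAvg_exp_le (hS : Subgroup.closure (lampGens a b) = ⊤) {w : List Bool}
    (hw : excCount w ≠ 0) {D μ : ℝ} (hD : 0 < D)
    (hD' : min (groupDiam (lampGens a b) : ℝ) (2 * excCount w + 3) ≤ D)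
    (hμ : μ ≤ patternAvg a b w (fun x => (wordLength (lampGens a b) x : ℝ)) 1) :
    patternAvg a b w (fun x => Real.exp (-(1 / (8 * D) * wordLength (lampGens a b) x))) 1 ≤
      Real.exp (-(7 / 8 * (1 / (8 * D)) * μ)) := by
  obtain ⟨h, t, hh, ht, H⟩ := patternAvg_normal a b hw
  have hlen : (h ++ (true :: (altPattern (excCount w) ++ t))).length ≤ 2 * excCount w + 3 := by
    simp only [List.length_append, List.length_cons, length_altPattern]
    rcases hh with rfl | rfl <;> rcases ht with rfl | rfl <;> simp <;> omega
  have hpos : 0 < 1 / (8 * D) := by positivity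
  calc _ ≤ patternAvg a b (h ++ (true :: (altPattern (excCount w) ++ t)))
        (fun x => 1 + (-(7 / 8 * (1 / (8 * D)))) * (wordLength (lampGens a b) x : ℝ)) 1 := by
        rw [H]
        refine patternAvg_mono_of_le a b hS _ _ fun x hx => ?_
        rw [wordLength_one, zero_add] at hx
        have h1 : (wordLength (lampGens a b) x : ℝ) ≤ D := by
          refine le_trans (le_min ?_ ?_) hD'
          · exact_mod_cast wordLength_le_groupDiam x
          · exact_mod_cast hx.trans hlen
        have h2 : 1 / (8 * D) * (wordLength (lampGens a b) x : ℝ) ≤ 1 / 8 := by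
          rw [div_mul_eq_mul_div, one_mul, div_le_iff₀ (by positivity)]
          linarith
        have := exp_neg_le_of_le (by positivity) h2
        linarith
    _ = 1 + (-(7 / 8 * (1 / (8 * D)))) *
        patternAvg a b w (fun x => (wordLength (lampGens a b) x : ℝ)) 1 := by
        rw [patternAvg_add, patternAvg_mul_left, patternAvg_const, H]
    _ ≤ 1 + (-(7 / 8 * (1 / (8 * D)) * μ)) := by
        have : 7 / 8 * (1 / (8 * D)) * μ ≤ 7 / 8 * (1 / (8 * D)) *
          patternAvg a b w (fun x => (wordLength (lampGens a b) x : ℝ)) 1 := by gcongr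
        linarith
    _ ≤ _ := by linarith [Real.add_one_le_exp (-(7 / 8 * (1 / (8 * D)) * μ))]

/-- Chernoff bound for independent sites. The mean contributes `7 / 8 * σ / 12`, the threshold takes
away `σ / 16`, and the difference `σ / 96` is multiplied by `1 / (8 * D)`. -/
theorem wordProb_sum_wordLength_lt_le (ha : Function.Injective a)
    (hA : 2 ≤ Fintype.card A) (hS : Subgroup.closure (lampGens a b) = ⊤) {σ T : ℝ} (hσ : 0 ≤ σ)
    (hσ3 : σ ≤ 3) (hT0 : 0 ≤ T) (hT : ∀ t : ℕ, (t : ℝ) ≤ T → σ * t ≤ lampSpeed a b t)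
    (k : ℕ) (e : List Bool) (X : Finset ℤ) {D : ℝ} (hD : 0 < D)
    (hD' : ∀ x, siteCount k 0 (e.map coinStep) x ≠ 0 →
      min (groupDiam (lampGens a b) : ℝ) (2 * siteCount k 0 (e.map coinStep) x + 3) ≤ D) :
    wordProb e.length (fun y : List ((A × B) × (A × B)) =>
      (∑ x ∈ X, (wordLength (lampGens a b)
        (((e.zip y).map (layerStep a b k)).prod.lamp x) : ℝ)) <
      σ / 16 * ∑ x ∈ X, min (siteCount k 0 (e.map coinStep) x : ℝ) T) ≤
    Real.exp (-(σ / (768 * D) * ∑ x ∈ X, min (siteCount k 0 (e.map coinStep) x : ℝ) T)) := by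
  set C : ℤ → ℕ := siteCount k 0 (e.map coinStep) with hC
  set S := ∑ x ∈ X, min (C x : ℝ) T with hSdef
  set Λ := 1 / (8 * D) with hΛ
  have hΛ0 : 0 < Λ := by positivity
  calc _ ≤ wordAvg e.length (fun y : List ((A × B) × (A × B)) => Real.exp (Λ * (σ / 16 * S)) *
        ∏ x ∈ X, Real.exp (-(Λ * wordLength (lampGens a b)
          ((1 * ((e.zip y).map (layerStep a b k)).prod).lamp x)))) := by
        refine wordProb_le_of_forall_le (fun y _ => by positivity) fun y _ hy => ?_
        rw [← Real.exp_sum, ← Real.exp_add, Real.one_le_exp_iff, Finset.sum_neg_distrib,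
          ← Finset.mul_sum, one_mul]
        nlinarith
    _ = Real.exp (Λ * (σ / 16 * S)) * ∏ x ∈ X, patternAvg a b
          (lettersAt x (switchWord k 0 (e.map coinStep)))
          (fun g => Real.exp (-(Λ * wordLength (lampGens a b) g))) 1 := by
        rw [wordAvg_mul_left, wordAvg_layerStep a b k
          (fun f => ∏ x ∈ X, Real.exp (-(Λ * wordLength (lampGens a b) (f x)))) e 1,
          lampAvg_prod a b X (fun _ g => Real.exp (-(Λ * wordLength (lampGens a b) g)))]
        rfl
    _ ≤ Real.exp (Λ * (σ / 16 * S)) *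
        ∏ x ∈ X, Real.exp (-(7 / 8 * Λ * (σ / 12 * min (C x : ℝ) T))) := by
        gcongr with x hx
        · exact fun x _ => le_patternAvg a b (fun g => (Real.exp_pos _).le) _ _
        -- Sites without alternations contribute a factor at most `1`, so `D` need not control them.
        · by_cases h0 : C x = 0
          · rw [h0, Nat.cast_zero, min_eq_left hT0, mul_zero, mul_zero, neg_zero, Real.exp_zero,
              ← patternAvg_const a b 1 (lettersAt x (switchWord k 0 (e.map coinStep))) 1]
            refine patternAvg_mono a b (fun g => ?_) _ _
            rw [Real.exp_le_one_iff, neg_nonpos]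
            positivity
          · refine patternAvg_exp_le a b hS h0 hD (hD' x h0) ?_
            refine le_patternAvg_wordLength a b ha hA hS hσ hσ3 hT0 (fun t ht => ?_) h0
            rw [← lampSpeed_eq]
            exact hT t ht
    _ = Real.exp (-(σ / (768 * D) * S)) := by
        rw [← Real.exp_sum, ← Real.exp_add, Finset.sum_neg_distrib, ← Finset.mul_sum,
          ← Finset.mul_sum]
        congr 1
        rw [hΛ]
        field_simp
        ring

end concentration

/-! ### The law of the increments -/

theorem uniformOfFintype_map_apply {Ξ H : Type*} [Fintype Ξ] [Nonempty Ξ] [DecidableEq H]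
    (st : Ξ → H) (h : H) :
    (PMF.uniformOfFintype Ξ).map st h =
      (Finset.univ.filter fun ξ => st ξ = h).card * (Fintype.card Ξ : ENNReal)⁻¹ := by
  rw [PMF.map_apply, tsum_fintype]
  simp only [PMF.uniformOfFintype_apply, eq_comm (a := h)]
  rw [← Finset.sum_filter, Finset.sum_const, nsmul_eq_mul]

/-- The probability of an event that concerns the first `n` terms of an i.i.d. sequence. -/
theorem measure_increments_le {Ξ H Ω : Type*} [Fintype Ξ] [Nonempty Ξ] [MeasurableSpace Ω]
    {P : Measure Ω} [IsProbabilityMeasure P] (st : Ξ → H) {X : ℕ → Ω → H}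
    (hlaw : letI : MeasurableSpace H := ⊤
      ∀ i, HasLaw (X i) ((PMF.uniformOfFintype Ξ).map st).toMeasure P)
    (hindep : letI : MeasurableSpace H := ⊤; iIndepFun X P) (n : ℕ) (bad : List H → Prop) :
    P {ω | bad ((List.range n).map fun i => X i ω)} ≤
      ENNReal.ofReal (wordProb n fun l : List Ξ => bad (l.map st)) := by
  classical
  let : MeasurableSpace H := ⊤
  set q := (PMF.uniformOfFintype Ξ).map st with hq
  have hpre : ∀ i (s : Set H), P (X i ⁻¹' s) = q.toMeasure s := by
    intro i s
    rw [← (hlaw i).map_eq, Measure.map_apply_of_aemeasurable (hlaw i).aemeasurable trivial]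
  -- `H` may be infinite. Outside the finite image `R` the increments have probability zero, which
  -- leaves finitely many cylinders. Only an upper bound is proved, so the event `bad` need not be
  -- measurable.
  set R : Finset H := Finset.univ.image st
  have hnull : ∀ i, P (X i ⁻¹' (R : Set H)ᶜ) = 0 := by
    intro i
    rw [hpre, PMF.toMeasure_apply_eq_zero_iff _ MeasurableSpace.measurableSet_top]
    rw [Set.disjoint_left]
    intro h hh hc
    obtain ⟨ξ, -, rfl⟩ := (PMF.mem_support_map_iff st _ h).mp hh
    exact hc (by simp [R])
  have hcyl : ∀ v : Fin n → H, P (⋂ i : Fin n, X i ⁻¹' {v i}) = ∏ i, q (v i) := by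
    intro v
    have h1 := (hindep.precomp (g := fun i : Fin n => (i : ℕ)) Fin.val_injective)
    have h2 := h1.measure_inter_preimage_eq_mul (S := Finset.univ) (sets := fun i => {v i})
      (fun i _ => trivial)
    simp only [Finset.mem_univ, Set.iInter_true] at h2
    rw [h2]
    refine Finset.prod_congr rfl fun i _ => ?_
    rw [hpre, PMF.toMeasure_apply_singleton _ _ MeasurableSpace.measurableSet_top]
  have hsub : {ω | bad ((List.range n).map fun i => X i ω)} ⊆
      (⋃ i : Fin n, X i ⁻¹' (R : Set H)ᶜ) ∪
      ⋃ v ∈ (Fintype.piFinset fun _ : Fin n => R).filter fun v => bad (List.ofFn v),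
        ⋂ i : Fin n, X i ⁻¹' {v i} := by
    intro ω hω
    by_cases hR : ∀ i : Fin n, X i ω ∈ R
    · refine Or.inr (Set.mem_biUnion (x := fun i : Fin n => X i ω) ?_ ?_)
      · rw [Finset.coe_filter]
        refine ⟨Fintype.mem_piFinset.mpr hR, ?_⟩
        have : (List.range n).map (fun i => X i ω) = List.ofFn fun i : Fin n => X i ω := by
          rw [← List.map_coe_finRange_eq_range, List.map_map, List.ofFn_eq_map]
          rfl
        rw [← this]
        exact hω
      · simp
    · push Not at hR
      obtain ⟨i, hi⟩ := hR
      exact Or.inl (Set.mem_iUnion.mpr ⟨i, hi⟩)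
  refine (measure_mono hsub).trans ((measure_union_le _ _).trans ?_)
  rw [measure_iUnion_null fun i : Fin n => hnull i, zero_add]
  refine (measure_biUnion_finset_le _ _).trans ?_
  simp only [hcyl]
  set N : ENNReal := (Fintype.card Ξ : ENNReal)
  have hcount : ∀ v : Fin n → H, ∏ i, q (v i) =
      ((Finset.univ.filter fun u : Fin n → Ξ => (fun i => st (u i)) = v).card : ENNReal) *
        (N⁻¹) ^ n := by
    intro v
    simp only [hq, uniformOfFintype_map_apply, Finset.prod_mul_distrib, Finset.prod_const,
      Finset.card_univ, Fintype.card_fin]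
    congr 1
    rw [← Nat.cast_prod, ← Fintype.card_piFinset]
    congr 2
    ext u
    simp [funext_iff]
  simp only [hcount]
  rw [← Finset.sum_mul, ← Nat.cast_sum]
  have hfib : ∑ v ∈ (Fintype.piFinset fun _ : Fin n => R).filter fun v => bad (List.ofFn v),
      (Finset.univ.filter fun u : Fin n → Ξ => (fun i => st (u i)) = v).card =
      (Finset.univ.filter fun u : Fin n → Ξ => bad (List.ofFn fun i => st (u i))).card := by
    rw [Finset.card_eq_sum_card_fiberwise (f := fun (u : Fin n → Ξ) i => st (u i))
      (t := (Fintype.piFinset fun _ : Fin n => R).filter fun v => bad (List.ofFn v))]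
    · refine Finset.sum_congr rfl fun v hv => ?_
      congr 1
      ext u
      simp only [Finset.mem_filter, Finset.mem_univ, true_and]
      constructor
      · rintro rfl
        exact ⟨(Finset.mem_filter.mp hv).2, rfl⟩
      · exact fun h => h.2
    · intro u hu
      simp only [Finset.coe_filter, Finset.mem_univ, true_and] at hu
      rw [Finset.coe_filter]
      exact ⟨Fintype.mem_piFinset.mpr fun i => by simp [R], hu⟩
  rw [hfib, wordProb, wordAvg_eq_sum, ENNReal.ofReal_div_of_pos (by positivity)]
  rw [Finset.sum_boole, ENNReal.ofReal_natCast, ENNReal.ofReal_pow (by positivity),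
    ENNReal.ofReal_natCast, div_eq_mul_inv, ENNReal.inv_pow]
  simp only [List.map_ofFn, Function.comp_def]
  exact le_rfl

/-! ### The switch-walk-switch distribution -/

theorem uniformOfFintype_prod (X Y : Type*) [Fintype X] [Nonempty X] [Fintype Y] [Nonempty Y] :
    PMF.uniformOfFintype (X × Y) =
      (PMF.uniformOfFintype X).bind fun x => (PMF.uniformOfFintype Y).map fun y => (x, y) := by
  classical
  ext ⟨x, y⟩
  rw [PMF.bind_apply, tsum_fintype, Finset.sum_eq_single x]
  · rw [PMF.map_apply, tsum_fintype, Finset.sum_eq_single y]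
    · simp only [PMF.uniformOfFintype_apply, if_true, Fintype.card_prod, Nat.cast_mul]
      rw [ENNReal.mul_inv (by simp) (by simp)]
    · intro y' _ h
      simp [Ne.symm h]
    · simp
  · intro x' _ h
    rw [PMF.map_apply]
    simp [Ne.symm h]
  · simp

section Delta

variable {A B : Type*} [Group A] [Group B] {Γ : ℕ → Type*}
  [∀ s, Group (Γ s)] (a : ∀ s, A →* Γ s) (b : ∀ s, B →* Γ s) (k : ℕ → ℕ)

/-- The element of `Δ` that corresponds to one step of the switch-walk-switch walk. -/
noncomputable def deltaStep (ξ : Bool × ((A × B) × (A × B))) : Delta a b k :=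
  deltaGen a b k (.alpha ξ.2.1.1) * deltaGen a b k (.beta ξ.2.1.2) *
    (if ξ.1 then deltaGen a b k .tau else (deltaGen a b k .tau)⁻¹) *
    (deltaGen a b k (.alpha ξ.2.2.1) * deltaGen a b k (.beta ξ.2.2.2))

theorem deltaStep_apply (ξ : Bool × ((A × B) × (A × B))) (s : ℕ) :
    (deltaStep a b k ξ).1 s = layerStep (a s) (b s) (k s) ξ := by
  obtain ⟨e, y⟩ := ξ
  cases e <;> rfl

/-- Drawing coin and letters as one uniform tuple separates the path from the letters, so the path
can be fixed first. The two commutations move the coin in front of the first two letters. -/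
theorem switchWalkSwitch_eq [Fintype A] [Fintype B] :
    switchWalkSwitch a b k =
      (PMF.uniformOfFintype (Bool × ((A × B) × (A × B)))).map (deltaStep a b k) := by
  simp only [uniformOfFintype_prod, switchWalkSwitch, convolve, uniformImage, PMF.map,
    PMF.bind_bind, PMF.pure_bind, Function.comp_def, deltaStep]
  conv_rhs => rw [PMF.bind_comm]
  congr 1
  funext i
  conv_rhs => rw [PMF.bind_comm]

theorem list_prod_apply (l : List (Delta a b k)) (s : ℕ) :
    (l.prod.1 s) = (l.map fun g => g.1 s).prod := by
  induction l with
  | nil => rfl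
  | cons g l ih =>
    rw [List.prod_cons, List.map_cons, List.prod_cons, ← ih]
    rfl

theorem mem_closure_layer (g : Delta a b k) (s : ℕ) :
    g.1 s ∈ Subgroup.closure (Set.range (layerGen (a s) (b s) (k s))) := by
  have h : Delta a b k ≤ (Subgroup.closure (Set.range (layerGen (a s) (b s) (k s)))).comap
      (Pi.evalMonoidHom _ s) := by
    refine (Subgroup.closure_le _).mpr ?_
    rintro _ ⟨j, rfl⟩
    exact Subgroup.subset_closure ⟨j, rfl⟩
  exact h g.2

theorem cursor_mul (g h : Delta a b k) : cursor (g * h) = cursor g + cursor h := rfl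

theorem cursor_deltaStep (ξ : Bool × ((A × B) × (A × B))) :
    cursor (deltaStep a b k ξ) = coinStep ξ.1 := by
  have := mul_layerStep_pos (a 0) (b 0) (k 0) 1 ξ
  rw [one_mul, Lamplighter.one_pos, zero_add] at this
  rw [cursor, deltaStep_apply, this]

theorem walk_eq_prod {Ω : Type*} (W : ℕ → Ω → Delta a b k) {ω : Ω} (h0 : W 0 ω = 1) (n : ℕ) :
    W n ω = ((List.range n).map fun i => (W i ω)⁻¹ * W (i + 1) ω).prod := by
  induction n with
  | zero => simpa using h0
  | succ n ih => rw [List.range_succ, List.map_append, List.prod_append, ← ih]; simp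

end Delta

/-! ### Alternations for `k = 0` and the range of the walk -/

theorem two_le_count_true {w : List Bool} (hw : excCount w ≠ 0) : 2 ≤ w.count true := by
  have h : ∀ (w : List Bool) (s : Bool), altCount s w ≤ w.count true := by
    intro w
    induction w with
    | nil => intro s; cases s <;> simp [altCount]
    | cons c w ih =>
      intro s
      have h1 := ih true
      have h2 := ih false
      cases s <;> cases c <;> simp [altCount] <;> omega
  induction w with
  | nil => exact absurd rfl hw
  | cons c w ih =>
    cases c
    · simpa using ih hw
    · have := h w true
      simp only [excCount] at hw
      simp
      have h3 : 0 < altCount true w := Nat.pos_of_ne_zero hw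
      exact List.count_pos_iff.mp (by omega)

theorem count_lettersAt_switchWord (k : ℕ) (x p : ℤ) (e : List ℤ) :
    (lettersAt x (switchWord k p e)).count true = (lettersAt x (switchWord 0 p e)).count true := by
  induction e generalizing p with
  | nil => rfl
  | cons s e ih =>
    simp only [lettersAt_switchWord_cons, List.count_append, ih]
    split_ifs <;> simp

theorem exists_lettersAt_switchWord_zero (x p : ℤ) (e : List ℤ) :
    ∃ m, lettersAt x (switchWord 0 p e) = (List.replicate m [true, false]).flatten := by
  induction e generalizing p with
  | nil => exact ⟨0, rfl⟩
  | cons s e ih =>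
    obtain ⟨m, hm⟩ := ih (p + s)
    rw [lettersAt_switchWord_cons, hm]
    simp only [Nat.cast_zero, add_zero]
    split_ifs
    · exact ⟨m + 1 + 1, rfl⟩
    · exact ⟨m + 1, rfl⟩
    · exact ⟨m + 1, rfl⟩
    · exact ⟨m, rfl⟩

/-- An alternation contains two `A`-letters at `x`, whose number does not depend on `k`. For `k = 0`
each of them is followed at once by a `B`, so two already give an alternation. -/
theorem siteCount_zero_ne_zero {k : ℕ} {p x : ℤ} {e : List ℤ} (h : siteCount k p e x ≠ 0) :
    siteCount 0 p e x ≠ 0 := by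
  have h2 := two_le_count_true h
  rw [count_lettersAt_switchWord] at h2
  obtain ⟨m, hm⟩ := exists_lettersAt_switchWord_zero x p e
  rw [siteCount, hm]
  rw [hm] at h2
  rcases m with _ | _ | m
  · simp at h2
  · simp at h2
  · simp [List.replicate_succ, excCount, altCount]

theorem siteCount_eq_zero_of_abs {k n : ℕ} {x : ℤ} {e : List Bool} (he : e.length = n)
    (hk : k ≤ n) (hx : x ∉ Finset.Icc (-(2 * n : ℤ)) (2 * n)) :
    siteCount k 0 (e.map coinStep) x = 0 := by
  have key : ∀ (e : List Bool) (p : ℤ), ∀ y ∈ switchSites k p (e.map coinStep),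
      p - e.length ≤ y ∧ y ≤ p + e.length + k := by
    intro e
    induction e with
    | nil => intro p y hy; simp [switchSites, switchWord] at hy
    | cons c e ih =>
      intro p y hy
      simp only [switchSites, List.map_cons, switchWord, List.toFinset_cons, Finset.mem_insert] at hy
      have hc : coinStep c = 1 ∨ coinStep c = -1 := by cases c <;> simp [coinStep]
      simp only [List.length_cons]
      push_cast
      rcases hy with rfl | rfl | rfl | rfl | hy
      · omega
      · omega
      · omega
      · omega
      · have := ih (p + coinStep c) y hy
        omega
  refine siteCount_eq_zero fun hmem => hx ?_
  have := key e 0 x hmem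
  rw [Finset.mem_Icc]
  omega

/-! ### Probability bounds for the counts -/

theorem wordProb_and_le {α : Type*} [Fintype α] {n : ℕ} {q : Prop} {p : List α → Prop} {β : ℝ}
    (hβ : 0 ≤ β) (h : q → wordProb n p ≤ β) : wordProb n (fun l => q ∧ p l) ≤ β := by
  by_cases hq : q
  · exact (wordProb_mono fun l _ hl => hl.2).trans (h hq)
  · refine le_trans ?_ hβ
    -- The bound `0` is written as `0 * 0` so that `wordAvg_mul_left` evaluates it even for an empty
    -- alphabet.
    have := wordProb_le_of_forall_le (n := n) (p := fun l => q ∧ p l) (F := fun _ => 0 * 0)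
      (fun l _ => by simp) (fun l _ hl => absurd hl.1 hq)
    rw [wordAvg_mul_left] at this
    simpa using this

/-- The square of the constant `d₂`. -/
noncomputable def scaleConst : ℝ := 9 / 12800 / 192

/-- With `y = log (2 ^ j)`, each of the `j + 1` layers fails with probability of order `y⁻³`, so the
sum over the dyadic times converges. -/
theorem wordProb_exists_totalCount_le (k : ℕ → ℕ) {j : ℕ} (hj : 3 ≤ j) :
    wordProb (2 ^ j) (fun u : List Bool => ∃ s ∈ Finset.range (j + 1),
      (k s ≠ 0 ∧ (k s : ℝ) ^ 2 * Real.log (j * Real.log 2) ≤ scaleConst * 2 ^ (j + 1)) ∧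
      (totalCount (k s) 0 (u.map coinStep) : ℝ) ≤
        9 / 12800 * (k s + 1) * (2 ^ j / (32 * k s ^ 2) : ℕ)) ≤
      2 * Real.exp (9 / 12800) / Real.log 2 ^ 3 * (1 / (j : ℝ) ^ 2) := by
  have hl2 : 0 < Real.log 2 := Real.log_pos (by norm_num)
  have hj' : (3 : ℝ) ≤ j := by exact_mod_cast hj
  set y := j * Real.log 2 with hy
  have hy0 : 0 < y := by positivity
  calc _ ≤ ∑ s ∈ Finset.range (j + 1), Real.exp (9 / 12800) * (1 / y ^ 3) := by
        refine (wordProb_exists_le _ _ _).trans (Finset.sum_le_sum fun s _ => ?_)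
        refine wordProb_and_le (by positivity) fun ⟨hk, hks⟩ => ?_
        set N := 2 ^ j / (32 * k s ^ 2) with hN
        refine (wordProb_totalCount_le hk (Nat.div_mul_le_self _ _) 0).trans ?_
        have hk0 : (0 : ℝ) < k s := by positivity
        have h1 : (2 : ℝ) ^ j < (N + 1) * (32 * k s ^ 2) := by
          have : 2 ^ j < (N + 1) * (32 * k s ^ 2) := by
            rw [Nat.add_mul, one_mul]
            exact Nat.lt_div_mul_add (by positivity)
          exact_mod_cast this
        -- Here `scaleConst` is fixed: `2 ^ j < 32 * k² * (N + 1)` turns the condition on `k` into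
        -- `log y ≤ 64 * scaleConst * (N + 1)`, and `192 * scaleConst = 9 / 12800`.
        have h2 : 3 * Real.log y ≤ 9 / 12800 * (N + 1) := by
          have h3 : (k s : ℝ) ^ 2 * Real.log y ≤ (k s : ℝ) ^ 2 * (scaleConst * 64 * (N + 1)) := by
            refine hks.trans ?_
            have : scaleConst * 2 ^ (j + 1) ≤ scaleConst * (2 * ((N + 1) * (32 * k s ^ 2))) := by
              rw [pow_succ']
              unfold scaleConst
              gcongr
            refine this.trans (le_of_eq ?_)
            ring
          have := le_of_mul_le_mul_left h3 (by positivity)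
          unfold scaleConst at this
          linarith
        have h4 : 1 / y ^ 3 = Real.exp (-(3 * Real.log y)) := by
          rw [Real.exp_neg, mul_comm, Real.exp_mul, Real.exp_log hy0, one_div]
          norm_cast
        rw [h4, ← Real.exp_add, Real.exp_le_exp]
        linarith
    _ = (j + 1) * (Real.exp (9 / 12800) * (1 / y ^ 3)) := by simp
    _ ≤ (2 * j) * (Real.exp (9 / 12800) * (1 / y ^ 3)) := by
        gcongr
        linarith
    _ = _ := by
        rw [hy]
        field_simp

/-- The bound for the number of alternations at a site. -/
noncomputable def siteBound (n k : ℕ) : ℕ := ⌈3 * √(n : ℝ) * Real.log n / k⌉₊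

/-- With `a = 1 / √n`, more than `3 √n log n / k` alternations at one site have probability of order
`n⁻⁶`; there are of order `n²` pairs of a layer and a site. -/
theorem wordProb_exists_siteCount_le (k : ℕ → ℕ) {n : ℕ} (hn : 1 ≤ n) :
    wordProb n (fun u : List Bool => ∃ s ∈ Finset.range (n + 1), (k s ≠ 0 ∧ k s ≤ n) ∧
      ∃ x, siteBound n (k s) + 1 ≤ siteCount (k s) 0 (u.map coinStep) x) ≤
      10 * Real.exp (1 / 2) * (1 / (n : ℝ) ^ 2) := by
  have hn' : (1 : ℝ) ≤ n := by exact_mod_cast hn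
  have hn0 : (0 : ℝ) < n := by linarith
  calc _ ≤ ∑ s ∈ Finset.range (n + 1), ∑ x ∈ Finset.Icc (-(2 * n : ℤ)) (2 * n),
        Real.exp (1 / 2) * (1 / (n : ℝ) ^ 6) := by
        refine (wordProb_exists_le _ _ _).trans (Finset.sum_le_sum fun s _ => ?_)
        refine wordProb_and_le (by positivity) fun ⟨hk, hkn⟩ => ?_
        refine le_trans (wordProb_mono (q := fun u : List Bool =>
          ∃ x ∈ Finset.Icc (-(2 * n : ℤ)) (2 * n),
            siteBound n (k s) + 1 ≤ siteCount (k s) 0 (u.map coinStep) x) ?_) ?_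
        · rintro u hu ⟨x, hx⟩
          refine ⟨x, by_contra fun hx' => ?_, hx⟩
          rw [siteCount_eq_zero_of_abs hu hkn hx'] at hx
          omega
        · refine (wordProb_exists_le _ _ _).trans (Finset.sum_le_sum fun x _ => ?_)
          refine (wordProb_siteCount_le (1 / √(n : ℝ)) (by positivity) hk x n _ 0).trans ?_
          have hk0 : (0 : ℝ) < k s := by positivity
          have hs0 : 0 < √(n : ℝ) := Real.sqrt_pos.mpr hn0
          have h1 : (1 / √(n : ℝ)) ^ 2 / 2 * n = 1 / 2 := by
            rw [div_pow, Real.sq_sqrt hn0.le]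
            field_simp
          have h2 : 6 * Real.log n ≤ 1 / √(n : ℝ) * k s * (2 * siteBound n (k s) + 1) := by
            have : 3 * √(n : ℝ) * Real.log n / k s ≤ siteBound n (k s) := Nat.le_ceil _
            have h3 : 1 / √(n : ℝ) * k s * (2 * (3 * √(n : ℝ) * Real.log n / k s) + 0) ≤
                1 / √(n : ℝ) * k s * (2 * siteBound n (k s) + 1) := by
              gcongr
              norm_num
            refine le_trans (le_of_eq ?_) h3
            field_simp
            ring
          have h4 : 1 / (n : ℝ) ^ 6 = Real.exp (-(6 * Real.log n)) := by
            rw [Real.exp_neg, mul_comm, Real.exp_mul, Real.exp_log hn0, one_div]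
            norm_cast
          rw [h4, ← Real.exp_add, Real.exp_le_exp, h1]
          linarith
    _ = ((n + 1) * (4 * n + 1)) * (Real.exp (1 / 2) * (1 / (n : ℝ) ^ 6)) := by
        have : (2 * (n : ℤ) + 1 - -(2 * n)).toNat = 4 * n + 1 := by omega
        simp only [Finset.sum_const, Finset.card_range, Int.card_Icc, nsmul_eq_mul, this]
        push_cast
        ring
    _ ≤ ((2 * n) * (5 * n)) * (Real.exp (1 / 2) * (1 / (n : ℝ) ^ 6)) := by
        gcongr <;> linarith
    _ = 10 * Real.exp (1 / 2) * (1 / (n : ℝ) ^ 4) := by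
        field_simp
        ring
    _ ≤ _ := by
        gcongr
        norm_num

theorem ae_eventually_notMem_of_le {Ω : Type*} [MeasurableSpace Ω] {P : Measure Ω}
    {E : ℕ → Set Ω} {f : ℕ → ℝ} (hE : ∀ n, P (E n) ≤ ENNReal.ofReal (f n)) (hf : Summable f) :
    ∀ᵐ ω ∂P, ∀ᶠ n in atTop, ω ∉ E n :=
  ae_eventually_notMem (ne_top_of_le_ne_top hf.tsum_ofReal_ne_top (ENNReal.tsum_le_tsum hE))

theorem summable_mul_exp_neg_rpow {c : ℝ} (hc : 0 < c) :
    Summable fun n : ℕ => ((n : ℝ) + 1) * Real.exp (-(c * (n : ℝ) ^ (1 / 8 : ℝ))) := by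
  -- The second summand only covers the term `n = 0`. Otherwise `exp t ≥ t ^ 24 / 24!` at `t = c * n
  -- ^ (1 / 8)` gives a cubic denominator.
  refine Summable.of_nonneg_of_le (fun n => by positivity) (fun n => ?_)
    ((Real.summable_one_div_nat_pow.mpr one_lt_two).mul_left (2 * (Nat.factorial 24 / c ^ 24)) |>.add
      (summable_of_ne_finset_zero (s := {0}) (f := fun n : ℕ => if n = 0 then (1 : ℝ) else 0)
        (fun b hb => by simp at hb; simp [hb])))
  rcases Nat.eq_zero_or_pos n with rfl | hn
  · simp [Real.zero_rpow]
  · have hn' : (1 : ℝ) ≤ n := by exact_mod_cast hn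
    have hn0 : (0 : ℝ) < n := by linarith
    rw [if_neg hn.ne', add_zero]
    have h1 := Real.pow_div_factorial_le_exp (c * (n : ℝ) ^ (1 / 8 : ℝ)) (by positivity) 24
    have h2 : (c * (n : ℝ) ^ (1 / 8 : ℝ)) ^ 24 = c ^ 24 * (n : ℝ) ^ 3 := by
      rw [mul_pow, ← Real.rpow_natCast ((n : ℝ) ^ (1 / 8 : ℝ)), ← Real.rpow_mul hn0.le]
      norm_num
    rw [h2] at h1
    rw [Real.exp_neg]
    calc ((n : ℝ) + 1) * (Real.exp (c * (n : ℝ) ^ (1 / 8 : ℝ)))⁻¹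
        ≤ (2 * n) * (c ^ 24 * (n : ℝ) ^ 3 / Nat.factorial 24)⁻¹ := by
          gcongr
          linarith
      _ = _ := by
          have : (Nat.factorial 24 : ℝ) ≠ 0 := by positivity
          field_simp

/-! ### Transfer to the random walk -/

section walk

variable {A B : Type*} [Group A] [Group B] {Γ : ℕ → Type*} [∀ s, Group (Γ s)]
  {a : ∀ s, A →* Γ s} {b : ∀ s, B →* Γ s} {k : ℕ → ℕ}
  {Ω : Type*}

/-- The first `n` steps of the projection of the walk to `ℤ`. -/
noncomputable def walkSteps (W : ℕ → Ω → Delta a b k) (n : ℕ) (ω : Ω) : List ℤ :=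
  (List.range n).map fun i => cursor ((W i ω)⁻¹ * W (i + 1) ω)

theorem length_walkSteps (W : ℕ → Ω → Delta a b k) (n : ℕ) (ω : Ω) :
    (walkSteps W n ω).length = n := by simp [walkSteps]

theorem walkSteps_append (W : ℕ → Ω → Delta a b k) {m n : ℕ} (h : m ≤ n) (ω : Ω) :
    ∃ v, walkSteps W n ω = walkSteps W m ω ++ v := by
  obtain ⟨r, rfl⟩ := Nat.exists_eq_add_of_le h
  rw [walkSteps, List.range_add, List.map_append]
  exact ⟨_, rfl⟩

theorem cursor_step (W : ℕ → Ω → Delta a b k) (n : ℕ) (ω : Ω) (i : ℕ)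
    (hi : i < (walkSteps W n ω).length) :
    cursor (W (i + 1) ω) = cursor (W i ω) + (walkSteps W n ω)[i] := by
  have : (walkSteps W n ω)[i] = cursor ((W i ω)⁻¹ * W (i + 1) ω) := by simp [walkSteps]
  rw [this, ← cursor_mul, mul_inv_cancel_left]

/-- The sum over all sites is bounded by the sum over the sites with a switch. -/
theorem tsum_min_excursionCount_le {W : ℕ → Ω → Delta a b k} (hW0 : ∀ ω, W 0 ω = 1) (ω : Ω) (n k' : ℕ) {T : ℝ}
    (hT : 0 ≤ T) :
    ∑' x : ℤ, min (excursionCount (fun t => cursor (W t ω)) k' x n : ℝ) T ≤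
      ∑ x ∈ switchSites k' 0 (walkSteps W n ω),
        min (siteCount k' 0 (walkSteps W n ω) x : ℝ) T := by
  have hle : ∀ x, excursionCount (fun t => cursor (W t ω)) k' x n ≤
      siteCount k' 0 (walkSteps W n ω) x := by
    intro x
    have := excursionCount_le_siteCount k' x (walkSteps W n ω) (fun t => cursor (W t ω))
      (cursor_step W n ω)
    rw [length_walkSteps] at this
    have h0 : cursor (W 0 ω) = 0 := by rw [hW0]; rfl
    rwa [h0] at this
  rw [tsum_eq_sum (s := switchSites k' 0 (walkSteps W n ω))]
  · refine Finset.sum_le_sum fun x _ => min_le_min_right _ ?_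
    exact_mod_cast hle x
  · intro x hx
    have := hle x
    rw [siteCount_eq_zero hx, Nat.le_zero] at this
    rw [this, Nat.cast_zero, min_eq_left hT]

theorem map_cursor_deltaStep (l : List (Bool × ((A × B) × (A × B)))) :
    (l.map (deltaStep a b k)).map cursor = (l.map Prod.fst).map coinStep := by
  simp only [List.map_map]
  exact List.map_congr_left fun ξ _ => cursor_deltaStep a b k ξ

variable [Fintype A] [Fintype B] [MeasurableSpace Ω] {P : Measure Ω} [IsProbabilityMeasure P]
  {W : ℕ → Ω → Delta a b k}

theorem measure_increments_le_wordProb (hW : IsRandomWalk (switchWalkSwitch a b k) P W) (n : ℕ)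
    (bad : List (Delta a b k) → Prop) :
    P {ω | bad ((List.range n).map fun i => (W i ω)⁻¹ * W (i + 1) ω)} ≤
      ENNReal.ofReal (wordProb n fun l => bad (l.map (deltaStep a b k))) := by
  obtain ⟨-, h1, h2⟩ := hW
  rw [switchWalkSwitch_eq] at h1
  exact measure_increments_le (deltaStep a b k) h1 h2 n bad

theorem measure_walkSteps_le (hW : IsRandomWalk (switchWalkSwitch a b k) P W) (n : ℕ)
    (bad : List ℤ → Prop) :
    P {ω | bad (walkSteps W n ω)} ≤
      ENNReal.ofReal (wordProb n fun u : List Bool => bad (u.map coinStep)) := by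
  classical
  have h := measure_increments_le_wordProb hW n fun L => bad (L.map cursor)
  simp only [List.map_map] at h
  refine h.trans (ENNReal.ofReal_le_ofReal (le_of_eq ?_))
  have h2 := wordAvg_prod n fun (u : List Bool) (_ : List ((A × B) × (A × B))) =>
    if bad (u.map coinStep) then (1 : ℝ) else 0
  simp only [wordAvg_const] at h2
  rw [wordProb, wordProb, ← h2]
  refine wordAvg_congr fun l _ => ?_
  rw [← map_cursor_deltaStep (a := a) (b := b) (k := k) l, List.map_map]

/-- A path on which the lamp lengths of a layer with diameter `l` are concentrated. -/
def GoodPath (k l n : ℕ) (T : ℝ) (e : List ℤ) : Prop :=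
  ∃ D : ℝ, 0 < D ∧
    (∀ x, siteCount k 0 e x ≠ 0 → min (l : ℝ) (2 * siteCount k 0 e x + 3) ≤ D) ∧
    (n : ℝ) ^ (1 / 8 : ℝ) * D ≤ ∑ x ∈ switchSites k 0 e, min (siteCount k 0 e x : ℝ) T

/-- The path is fixed first: a path that is not good contributes nothing, and on a good one
`GoodPath` makes the Chernoff exponent at least `σ / 768 * n ^ (1 / 8)`. -/
theorem measure_sum_wordLength_lt_le [∀ s, Fintype (Γ s)]
    (hW : IsRandomWalk (switchWalkSwitch a b k) P W) (s : ℕ)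
    (ha : Function.Injective (a s)) (hA : 2 ≤ Fintype.card A)
    (hS : Subgroup.closure (lampGens (a s) (b s)) = ⊤) {σ T : ℝ} (hσ : 0 ≤ σ)
    (hσ3 : σ ≤ 3) (hT0 : 0 ≤ T) (hT : ∀ t : ℕ, (t : ℝ) ≤ T → σ * t ≤ lampSpeed (a s) (b s) t)
    (n : ℕ) :
    P {ω | GoodPath (k s) (groupDiam (lampGens (a s) (b s))) n T (walkSteps W n ω) ∧
      (∑ x ∈ switchSites (k s) 0 (walkSteps W n ω),
        (wordLength (lampGens (a s) (b s)) (((W n ω).1 s).lamp x) : ℝ)) <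
      σ / 16 * ∑ x ∈ switchSites (k s) 0 (walkSteps W n ω),
        min (siteCount (k s) 0 (walkSteps W n ω) x : ℝ) T} ≤
    ENNReal.ofReal (Real.exp (-(σ / 768 * (n : ℝ) ^ (1 / 8 : ℝ)))) := by
  classical
  set bad : List ℤ → Lamplighter (Γ s) → Prop := fun e g =>
    GoodPath (k s) (groupDiam (lampGens (a s) (b s))) n T e ∧
      (∑ x ∈ switchSites (k s) 0 e, (wordLength (lampGens (a s) (b s)) (g.lamp x) : ℝ)) <
      σ / 16 * ∑ x ∈ switchSites (k s) 0 e, min (siteCount (k s) 0 e x : ℝ) T with hbad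
  have h := measure_increments_le_wordProb hW n fun L => bad (L.map cursor) (L.prod.1 s)
  have hset : {ω | bad (walkSteps W n ω) ((W n ω).1 s)} =
      {ω | bad (((List.range n).map fun i => (W i ω)⁻¹ * W (i + 1) ω).map cursor)
        (((List.range n).map fun i => (W i ω)⁻¹ * W (i + 1) ω).prod.1 s)} := by
    ext ω
    rw [Set.mem_ofPred_eq, Set.mem_ofPred_eq, ← walk_eq_prod a b k W (hW.1 ω) n, List.map_map]
    rfl
  change P {ω | bad (walkSteps W n ω) ((W n ω).1 s)} ≤ _
  rw [hset]
  refine h.trans (ENNReal.ofReal_le_ofReal ?_)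
  have h2 := wordAvg_prod n fun (u : List Bool) (v : List ((A × B) × (A × B))) =>
    if bad (u.map coinStep) (((u.zip v).map (layerStep (a s) (b s) (k s))).prod) then (1 : ℝ) else 0
  have h3 : wordProb n (fun l : List (Bool × ((A × B) × (A × B))) =>
      bad ((l.map (deltaStep a b k)).map cursor) ((l.map (deltaStep a b k)).prod.1 s)) =
      wordAvg n fun u : List Bool => wordProb n fun v : List ((A × B) × (A × B)) =>
        bad (u.map coinStep) (((u.zip v).map (layerStep (a s) (b s) (k s))).prod) := by
    rw [wordProb]
    refine Eq.trans (wordAvg_congr fun l _ => ?_) (h2.trans (wordAvg_congr fun u _ =>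
      wordAvg_congr fun v _ => by congr))
    have hz : (l.map Prod.fst).zip (l.map Prod.snd) = l := by
      rw [List.zip_map']
      simp
    have hs : (l.map (deltaStep a b k)).map (fun g => g.1 s) =
        l.map (layerStep (a s) (b s) (k s)) := by
      rw [List.map_map]
      exact List.map_congr_left fun ξ _ => deltaStep_apply a b k ξ s
    rw [map_cursor_deltaStep, list_prod_apply, hs, hz]
    congr
  rw [h3, ← wordAvg_const (α := Bool) n (Real.exp (-(σ / 768 * (n : ℝ) ^ (1 / 8 : ℝ))))]
  refine wordAvg_mono fun u hu => ?_
  simp only [hbad]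
  refine wordProb_and_le (Real.exp_pos _).le fun ⟨D, hD, hD1, hD2⟩ => ?_
  subst hu
  refine (wordProb_sum_wordLength_lt_le (a s) (b s) ha hA hS hσ hσ3 hT0 hT (k s) u _ hD hD1).trans ?_
  rw [Real.exp_le_exp, neg_le_neg_iff]
  calc σ / 768 * (u.length : ℝ) ^ (1 / 8 : ℝ) =
      σ / (768 * D) * ((u.length : ℝ) ^ (1 / 8 : ℝ) * D) := by field_simp
    _ ≤ _ := by gcongr

end walk

/-! ### Good paths -/

/-- Take `D = min l H`. For a site with count `C ≤ H`, both `C * D ≤ H * C` and `C * D ≤ H * l`,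
hence `c * C * D ≤ H * min C (c * l)`. Summing over the sites bounds the truncated sum by the total
count. -/
theorem goodPath_of_totalCount {k l n : ℕ} {c H : ℝ} {e : List ℤ} (hl : 1 ≤ l)
    (hc : 0 < c) (hc1 : c < 1) (hH : 0 < H) (hC : ∀ x, 2 * (siteCount k 0 e x : ℝ) + 3 ≤ H)
    (ht : (n : ℝ) ^ (1 / 8 : ℝ) * H ≤ c * totalCount k 0 e) :
    GoodPath k l n (c * l) e := by
  have hl' : (1 : ℝ) ≤ l := by exact_mod_cast hl
  refine ⟨min l H, lt_min (by linarith) hH, fun x _ => min_le_min_left _ (hC x), ?_⟩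
  set D := min (l : ℝ) H with hD
  have hD0 : 0 < D := lt_min (by linarith) hH
  have key : ∀ x, c * (siteCount k 0 e x * D) ≤ H * min (siteCount k 0 e x : ℝ) (c * l) := by
    intro x
    set C : ℝ := (siteCount k 0 e x : ℝ) with hCdef
    have hC0 : 0 ≤ C := by positivity
    have hCH : C ≤ H := by linarith [hC x]
    rw [mul_min_of_nonneg _ _ hH.le]
    refine le_min ?_ ?_
    · have : C * D ≤ C * H := mul_le_mul_of_nonneg_left (min_le_right _ _) hC0
      nlinarith [mul_nonneg hC0 hD0.le]
    · have : C * D ≤ H * l := mul_le_mul hCH (min_le_left _ _) hD0.le hH.le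
      nlinarith
  have hsum : c * (totalCount k 0 e * D) ≤
      H * ∑ x ∈ switchSites k 0 e, min (siteCount k 0 e x : ℝ) (c * l) := by
    rw [totalCount, Nat.cast_sum, Finset.sum_mul, Finset.mul_sum, Finset.mul_sum]
    exact Finset.sum_le_sum fun x _ => key x
  refine le_of_mul_le_mul_left ?_ hH
  calc H * ((n : ℝ) ^ (1 / 8 : ℝ) * D) = ((n : ℝ) ^ (1 / 8 : ℝ) * H) * D := by ring
    _ ≤ (c * totalCount k 0 e) * D := by gcongr
    _ = c * (totalCount k 0 e * D) := by ring
    _ ≤ _ := hsum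

/-- Here `k` belongs to another layer. Every site with an alternation there contributes at least `c`
for `k = 0`, and there are at least `totalCount / H` such sites. The bound `D = l` is harmless
because this is applied to a single fixed layer. -/
theorem goodPath_zero_of_totalCount {k l n : ℕ} {c H : ℝ} {e : List ℤ} (hl : 1 ≤ l)
    (hc : 0 < c) (hc1 : c < 1) (hH : 0 < H) (hC : ∀ x, 2 * (siteCount k 0 e x : ℝ) + 3 ≤ H)
    (ht : (n : ℝ) ^ (1 / 8 : ℝ) * H * l ≤ c * totalCount k 0 e) :
    GoodPath 0 l n (c * l) e := by
  have hl' : (1 : ℝ) ≤ l := by exact_mod_cast hl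
  refine ⟨l, by linarith, fun x _ => min_le_left _ _, ?_⟩
  have key : ∀ x, c * (siteCount k 0 e x : ℝ) ≤ H * min (siteCount 0 0 e x : ℝ) (c * l) := by
    intro x
    by_cases h0 : siteCount k 0 e x = 0
    · rw [h0]
      have : 0 ≤ min (siteCount 0 0 e x : ℝ) (c * l) := by positivity
      simpa using mul_nonneg hH.le this
    · have h1 : (1 : ℝ) ≤ siteCount 0 0 e x := by
        exact_mod_cast Nat.one_le_iff_ne_zero.mpr (siteCount_zero_ne_zero h0)
      have h2 : c ≤ min (siteCount 0 0 e x : ℝ) (c * l) := by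
        refine le_min (by linarith) ?_
        nlinarith
      have h3 : (siteCount k 0 e x : ℝ) ≤ H := by linarith [hC x, (siteCount k 0 e x).cast_nonneg (α := ℝ)]
      calc c * (siteCount k 0 e x : ℝ) ≤ c * H := by gcongr
        _ = H * c := mul_comm _ _
        _ ≤ _ := by gcongr
  have hsum : c * (totalCount k 0 e : ℝ) ≤
      H * ∑ x ∈ switchSites 0 0 e, min (siteCount 0 0 e x : ℝ) (c * l) := by
    have h1 : ∑ x ∈ switchSites 0 0 e, min (siteCount 0 0 e x : ℝ) (c * l) =
        ∑ x ∈ switchSites k 0 e ∪ switchSites 0 0 e, min (siteCount 0 0 e x : ℝ) (c * l) := by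
      refine Finset.sum_subset Finset.subset_union_right fun x _ hx => ?_
      rw [siteCount_eq_zero hx, Nat.cast_zero, min_eq_left (by positivity)]
    rw [h1, totalCount_eq_sum (X := switchSites k 0 e ∪ switchSites 0 0 e)
      Finset.subset_union_left, Nat.cast_sum, Finset.mul_sum, Finset.mul_sum]
    exact Finset.sum_le_sum fun x _ => key x
  refine le_of_mul_le_mul_left ?_ hH
  calc H * ((n : ℝ) ^ (1 / 8 : ℝ) * l) = (n : ℝ) ^ (1 / 8 : ℝ) * H * l := by ring
    _ ≤ _ := ht.trans hsum

theorem two_pow_le_of_two_mul_lt {k : ℕ → ℕ} (hk : ∀ s, 2 * k s < k (s + 1)) (s : ℕ) :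
    2 ^ s ≤ k s + 1 := by
  induction s with
  | zero => simp
  | succ s ih =>
    have := hk s
    rw [pow_succ]
    omega

/-- Bounds for the counts outside the exceptional events. -/
theorem counts_of_not_exceptional {k : ℕ → ℕ} (hk : ∀ s, 2 * k s < k (s + 1)) {n s : ℕ}
    (hn : 8 ≤ n) (hll : 1 ≤ Real.log (Real.log n)) (hks0 : k s ≠ 0)
    (hks : (k s : ℝ) ^ 2 * Real.log (Real.log n) ≤ scaleConst * n) {e u v : List ℤ}
    (huv : e = u ++ v)
    (h1 : ¬ ∃ s ∈ Finset.range (Nat.log 2 n + 1),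
      (k s ≠ 0 ∧ (k s : ℝ) ^ 2 * Real.log (Nat.log 2 n * Real.log 2) ≤
        scaleConst * 2 ^ (Nat.log 2 n + 1)) ∧
      (totalCount (k s) 0 u : ℝ) ≤
        9 / 12800 * (k s + 1) * (2 ^ Nat.log 2 n / (32 * k s ^ 2) : ℕ))
    (h2 : ¬ ∃ s ∈ Finset.range (n + 1), (k s ≠ 0 ∧ k s ≤ n) ∧
      ∃ x, siteBound n (k s) + 1 ≤ siteCount (k s) 0 e x) :
    s ≤ n ∧ (∀ x, 2 * (siteCount (k s) 0 e x : ℝ) + 3 ≤ 11 * √(n : ℝ) * Real.log n / k s) ∧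
      9 / 12800 / 128 * (n : ℝ) / k s ≤ totalCount (k s) 0 e := by
  set j := Nat.log 2 n with hj
  have hj3 : 3 ≤ j := (Nat.le_log_iff_pow_le (by norm_num) (by omega)).mpr (by omega)
  have hjn : 2 ^ j ≤ n := Nat.pow_log_le_self 2 (by omega)
  have hnj : n < 2 ^ (j + 1) := Nat.lt_pow_succ_log_self (by norm_num) n
  have hjn' : (2 : ℝ) ^ j ≤ n := by exact_mod_cast hjn
  have hnj' : (n : ℝ) ≤ 2 * 2 ^ j := by
    rw [← pow_succ']
    exact_mod_cast hnj.le
  have hk0 : (1 : ℝ) ≤ k s := by exact_mod_cast Nat.one_le_iff_ne_zero.mpr hks0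
  have hn' : (8 : ℝ) ≤ n := by exact_mod_cast hn
  have hk2 : (k s : ℝ) ^ 2 ≤ scaleConst * n := by nlinarith
  have h32 : 32 * (k s) ^ 2 ≤ 2 ^ j := by
    have : 32 * (k s : ℝ) ^ 2 ≤ 2 ^ j := by
      unfold scaleConst at hk2
      linarith
    exact_mod_cast this
  have hkj : k s ≤ 2 ^ j := by nlinarith
  -- As `k` doubles from layer to layer, only logarithmically many layers lie below the threshold.
  have hsj : s ≤ j := by
    have h3 := (two_pow_le_of_two_mul_lt hk s).trans (Nat.add_le_add_right hkj 1)
    by_contra hlt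
    have h4 : 2 ^ (j + 1) ≤ 2 ^ s := Nat.pow_le_pow_right (by norm_num) (by omega)
    have h5 : 2 ^ 3 ≤ 2 ^ j := Nat.pow_le_pow_right (by norm_num) hj3
    rw [pow_succ] at h4
    omega
  have hjle : j ≤ n := Nat.log_le_self 2 n
  have hlogn : 1 ≤ Real.log n := by
    by_contra hlt
    have : Real.log (Real.log n) ≤ 0 :=
      Real.log_nonpos (Real.log_nonneg (by linarith)) (not_le.mp hlt).le
    linarith
  refine ⟨hsj.trans hjle, fun x => ?_, ?_⟩
  · have h3 : siteCount (k s) 0 e x ≤ siteBound n (k s) := by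
      by_contra hlt
      exact h2 ⟨s, Finset.mem_range.mpr (by omega), ⟨hks0, hkj.trans hjn⟩, x, by omega⟩
    have h4 : (siteBound n (k s) : ℝ) ≤ 3 * √(n : ℝ) * Real.log n / k s + 1 := by
      refine (Nat.ceil_lt_add_one ?_).le
      positivity
    have h5 : (siteCount (k s) 0 e x : ℝ) ≤ siteBound n (k s) := by exact_mod_cast h3
    -- Since `z = √n log n / k ≥ 1`, the bound `2 * (3 * z + 1) + 3` is at most `11 * z`.
    have h6 : 1 ≤ √(n : ℝ) * Real.log n / k s := by
      rw [le_div_iff₀ (by linarith), one_mul]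
      have h7 : (k s : ℝ) ≤ √(n : ℝ) := by
        refine Real.le_sqrt_of_sq_le (hk2.trans ?_)
        unfold scaleConst
        linarith
      nlinarith [Real.sqrt_nonneg (n : ℝ)]
    have e1 : 3 * √(n : ℝ) * Real.log n / k s = 3 * (√(n : ℝ) * Real.log n / k s) := by ring
    have e2 : 11 * √(n : ℝ) * Real.log n / k s = 11 * (√(n : ℝ) * Real.log n / k s) := by ring
    rw [e1] at h4
    rw [e2]
    linarith
  · set N := 2 ^ j / (32 * k s ^ 2) with hN
    have hN1 : 1 ≤ N := (Nat.one_le_div_iff (by positivity)).mpr h32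
    have hNlt : 2 ^ j < (N + 1) * (32 * k s ^ 2) := by
      rw [Nat.add_mul, one_mul]
      exact Nat.lt_div_mul_add (by positivity)
    have hNlt' : (2 : ℝ) ^ j < (N + 1) * (32 * k s ^ 2) := by exact_mod_cast hNlt
    have hN1' : (1 : ℝ) ≤ N := by exact_mod_cast hN1
    -- The factor `128` collects `n ≤ 2 * 2 ^ j`, `N + 1 ≤ 2 * N` and the block length `32 * k²`.
    have hnN : (n : ℝ) ≤ 128 * N * (k s : ℝ) ^ 2 := by
      have : ((N : ℝ) + 1) * (32 * k s ^ 2) ≤ (2 * N) * (32 * k s ^ 2) := by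
        gcongr
        linarith
      linarith
    have hcond : (k s : ℝ) ^ 2 * Real.log (j * Real.log 2) ≤ scaleConst * 2 ^ (j + 1) := by
      have h3 : Real.log (j * Real.log 2) ≤ Real.log (Real.log n) := by
        refine Real.log_le_log ?_ ?_
        · have : 0 < Real.log 2 := Real.log_pos (by norm_num)
          have : (0 : ℝ) < j := by exact_mod_cast (by omega : 0 < j)
          positivity
        · rw [← Real.log_pow]
          exact Real.log_le_log (by positivity) hjn'
      calc (k s : ℝ) ^ 2 * Real.log (j * Real.log 2) ≤ (k s : ℝ) ^ 2 * Real.log (Real.log n) := by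
            gcongr
        _ ≤ scaleConst * n := hks
        _ ≤ _ := by
            rw [pow_succ']
            unfold scaleConst
            gcongr
    have h3 : 9 / 12800 * ((k s : ℝ) + 1) * N < totalCount (k s) 0 u := by
      by_contra hlt
      exact h1 ⟨s, Finset.mem_range.mpr (by omega), ⟨hks0, hcond⟩, not_lt.mp hlt⟩
    have h4 : (totalCount (k s) 0 u : ℝ) ≤ totalCount (k s) 0 e := by
      have := totalCount_append (k s) 0 u v
      rw [← huv] at this
      exact_mod_cast (Nat.le_add_right _ _).trans this
    refine le_trans ?_ (h3.le.trans h4)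
    rw [div_le_iff₀ (by linarith)]
    nlinarith [mul_nonneg (by linarith : (0 : ℝ) ≤ k s) (by linarith : (0 : ℝ) ≤ N)]

/-! ### Asymptotic comparisons and degenerate cases. -/

/-- The logarithm is absorbed by another `n ^ (1 / 8)`, and `1 / 8 + 1 / 2 + 1 / 8 < 1`. -/
theorem eventually_rpow_mul_log_le {K ε : ℝ} (hε : 0 < ε) :
    ∀ᶠ n : ℕ in atTop,
      (n : ℝ) ^ (1 / 8 : ℝ) * (11 * √(n : ℝ) * Real.log n) * K ≤ ε * n := by
  have h := (isLittleO_log_rpow_atTop (r := 1 / 8) (by norm_num)).bound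
    (show 0 < ε / (11 * (|K| + 1)) by positivity)
  filter_upwards [tendsto_natCast_atTop_atTop.eventually h, eventually_ge_atTop 1] with n hn h1
  have hn1 : (1 : ℝ) ≤ n := by exact_mod_cast h1
  have hn0 : (0 : ℝ) < n := by linarith
  rw [Real.norm_of_nonneg (Real.log_nonneg hn1), Real.norm_of_nonneg (by positivity)] at hn
  have hlog := Real.log_nonneg hn1
  calc (n : ℝ) ^ (1 / 8 : ℝ) * (11 * √(n : ℝ) * Real.log n) * K
      ≤ (n : ℝ) ^ (1 / 8 : ℝ) * (11 * √(n : ℝ) * Real.log n) * (|K| + 1) :=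
        mul_le_mul_of_nonneg_left (by linarith [le_abs_self K]) (by positivity)
    _ ≤ (n : ℝ) ^ (1 / 8 : ℝ) * (11 * √(n : ℝ) * (ε / (11 * (|K| + 1)) * (n : ℝ) ^ (1 / 8 : ℝ))) *
        (|K| + 1) := by gcongr
    _ = ε * ((n : ℝ) ^ (1 / 8 : ℝ) * (n : ℝ) ^ (1 / 2 : ℝ) * (n : ℝ) ^ (1 / 8 : ℝ)) := by
        rw [Real.sqrt_eq_rpow]
        have : |K| + 1 ≠ 0 := by positivity
        field_simp
    _ ≤ ε * n := by
        gcongr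
        rw [← Real.rpow_add hn0, ← Real.rpow_add hn0]
        nth_rewrite 2 [← Real.rpow_one (n : ℝ)]
        exact Real.rpow_le_rpow_of_exponent_le hn1 (by norm_num)

theorem groupDiam_le_one {A B G : Type*} [Group A] [Fintype A] [Group B] [Group G]
    [Fintype G] (a : A →* G) (b : B →* G) (hS : Subgroup.closure (lampGens a b) = ⊤)
    (hA : Fintype.card A < 2) : groupDiam (lampGens a b) ≤ 1 := by
  have : Subsingleton A := Fintype.card_le_one_iff_subsingleton.mp (by omega)
  have hle : Subgroup.closure (lampGens a b) ≤ b.range := by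
    refine (Subgroup.closure_le _).mpr ?_
    rintro x (⟨i, rfl⟩ | ⟨i, rfl⟩)
    · rw [Subsingleton.elim i 1, map_one]
      exact b.range.one_mem
    · exact ⟨i, rfl⟩
  refine Finset.sup_le fun g _ => wordLength_le_one (Or.inl (Or.inr ?_))
  have : g ∈ Subgroup.closure (lampGens a b) := by simp [hS]
  exact hle this

theorem sqrt_threshold {k n : ℕ} (hll : 0 < Real.log (Real.log n))
    (h : (k : ℝ) ≤ √scaleConst * √(n : ℝ) / √(Real.log (Real.log n))) :
    (k : ℝ) ^ 2 * Real.log (Real.log n) ≤ scaleConst * n := by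
  rw [le_div_iff₀ (Real.sqrt_pos.mpr hll)] at h
  have h1 := pow_le_pow_left₀ (by positivity) h 2
  rw [mul_pow, mul_pow, Real.sq_sqrt hll.le, Real.sq_sqrt (by unfold scaleConst; norm_num),
    Real.sq_sqrt (by positivity)] at h1
  exact h1

theorem eventually_sq_mul_loglog_le (k : ℕ) :
    ∀ᶠ n : ℕ in atTop, (k : ℝ) ^ 2 * Real.log (Real.log n) ≤ scaleConst * n := by
  have hs : 0 < scaleConst := by unfold scaleConst; norm_num
  have h := Real.isLittleO_log_id_atTop.bound
    (show 0 < scaleConst / ((k : ℝ) ^ 2 + 1) by positivity)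
  filter_upwards [tendsto_natCast_atTop_atTop.eventually h, eventually_ge_atTop 3] with n hn h3
  have hn3 : (3 : ℝ) ≤ n := by exact_mod_cast h3
  have hlog : 0 < Real.log n := Real.log_pos (by linarith)
  simp only [id] at hn
  rw [Real.norm_of_nonneg hlog.le, Real.norm_of_nonneg (by linarith)] at hn
  have h1 : Real.log (Real.log n) ≤ Real.log n := by linarith [Real.log_le_sub_one_of_pos hlog]
  calc (k : ℝ) ^ 2 * Real.log (Real.log n) ≤ (k : ℝ) ^ 2 * Real.log n := by gcongr
    _ ≤ ((k : ℝ) ^ 2 + 1) * Real.log n := by gcongr; linarith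
    _ ≤ ((k : ℝ) ^ 2 + 1) * (scaleConst / ((k : ℝ) ^ 2 + 1) * n) := by gcongr
    _ = _ := by field_simp

/-! ### Borel–Cantelli and the conclusion. -/

section main

variable {A B : Type*} [Group A] [Fintype A] [Group B] [Fintype B]
  {Γ : ℕ → Type*} [∀ s, Group (Γ s)]
  {a : ∀ s, A →* Γ s} {b : ∀ s, B →* Γ s} {k : ℕ → ℕ}
  {Ω : Type*} [MeasurableSpace Ω] {P : Measure Ω} [IsProbabilityMeasure P]
  {W : ℕ → Ω → Delta a b k}

/-- Almost surely, all layers with a small `k s` see a good path. -/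
theorem ae_eventually_goodPath (hk : ∀ s, 2 * k s < k (s + 1)) {c₀ : ℝ} (hc : 0 < c₀)
    (hc1 : c₀ < 1) (l : ℕ → ℕ) (hW : IsRandomWalk (switchWalkSwitch a b k) P W) :
    ∀ᵐ ω ∂P, ∀ᶠ n : ℕ in atTop, ∀ s : ℕ, l s ≠ 0 →
      (k s : ℝ) ≤ √scaleConst * √(n : ℝ) / √(Real.log (Real.log n)) →
      s ≤ n ∧ GoodPath (k s) (l s) n (c₀ * l s) (walkSteps W n ω) := by
  -- This failure probability is only polylogarithmic in the time, hence summable along dyadic times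
  -- but not over all times; monotonicity of the count fills the gaps.
  have E1 : ∀ᵐ ω ∂P, ∀ᶠ j : ℕ in atTop, ω ∉ {ω | 3 ≤ j ∧ ∃ s ∈ Finset.range (j + 1),
      (k s ≠ 0 ∧ (k s : ℝ) ^ 2 * Real.log (j * Real.log 2) ≤ scaleConst * 2 ^ (j + 1)) ∧
      (totalCount (k s) 0 (walkSteps W (2 ^ j) ω) : ℝ) ≤
        9 / 12800 * (k s + 1) * (2 ^ j / (32 * k s ^ 2) : ℕ)} := by
    refine ae_eventually_notMem_of_le (fun j => ?_)
      ((Real.summable_one_div_nat_pow.mpr one_lt_two).mul_left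
        (2 * Real.exp (9 / 12800) / Real.log 2 ^ 3))
    by_cases hj : 3 ≤ j
    · refine (measure_mono fun ω hω => hω.2).trans
        ((measure_walkSteps_le hW (2 ^ j) fun e => ∃ s ∈ Finset.range (j + 1),
        (k s ≠ 0 ∧ (k s : ℝ) ^ 2 * Real.log (j * Real.log 2) ≤ scaleConst * 2 ^ (j + 1)) ∧
        (totalCount (k s) 0 e : ℝ) ≤
          9 / 12800 * (k s + 1) * (2 ^ j / (32 * k s ^ 2) : ℕ)).trans
        (ENNReal.ofReal_le_ofReal (wordProb_exists_totalCount_le k hj)))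
    · simp [hj]
  have E2 : ∀ᵐ ω ∂P, ∀ᶠ n : ℕ in atTop, ω ∉ {ω | 1 ≤ n ∧
      ∃ s ∈ Finset.range (n + 1), (k s ≠ 0 ∧ k s ≤ n) ∧
      ∃ x, siteBound n (k s) + 1 ≤ siteCount (k s) 0 (walkSteps W n ω) x} := by
    refine ae_eventually_notMem_of_le (fun n => ?_)
      ((Real.summable_one_div_nat_pow.mpr one_lt_two).mul_left (10 * Real.exp (1 / 2)))
    by_cases hn : 1 ≤ n
    · refine (measure_mono fun ω hω => hω.2).trans
        ((measure_walkSteps_le hW n fun e => ∃ s ∈ Finset.range (n + 1), (k s ≠ 0 ∧ k s ≤ n) ∧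
        ∃ x, siteBound n (k s) + 1 ≤ siteCount (k s) 0 e x).trans
        (ENNReal.ofReal_le_ofReal (wordProb_exists_siteCount_le k hn)))
    · simp [hn]
  have hlogtop : Tendsto (fun n : ℕ => Nat.log 2 n) atTop atTop :=
    tendsto_atTop.mpr fun m => (eventually_ge_atTop (2 ^ m)).mono fun n hn =>
      Nat.le_log_of_pow_le (by norm_num) hn
  have hll : ∀ᶠ n : ℕ in atTop, 1 ≤ Real.log (Real.log n) :=
    ((Real.tendsto_log_atTop.comp Real.tendsto_log_atTop).comp
      tendsto_natCast_atTop_atTop).eventually_ge_atTop 1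
  have hε : 0 < c₀ * (9 / 12800 / 128) := by positivity
  filter_upwards [E1, E2] with ω h1 h2
  filter_upwards [hlogtop.eventually h1, h2, hll, eventually_ge_atTop 8,
    eventually_sq_mul_loglog_le (k 1), eventually_rpow_mul_log_le (K := 1) hε,
    eventually_rpow_mul_log_le (K := l 0) hε] with n h1 h2 hll hn hk1 hK1 hK0 s hl hks
  have hl1 : 1 ≤ l s := Nat.one_le_iff_ne_zero.mpr hl
  have hjn : 2 ^ Nat.log 2 n ≤ n := Nat.pow_log_le_self 2 (by omega)
  have hj3 : 3 ≤ Nat.log 2 n := Nat.le_log_of_pow_le (by norm_num) (by omega)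
  obtain ⟨v, hv⟩ := walkSteps_append W hjn ω
  have hn' : (8 : ℝ) ≤ n := by exact_mod_cast hn
  have hlogn : 0 < Real.log n := Real.log_pos (by linarith)
  have counts : ∀ s, k s ≠ 0 → (k s : ℝ) ^ 2 * Real.log (Real.log n) ≤ scaleConst * n → _ :=
    fun s hs0 hs => counts_of_not_exceptional hk hn hll hs0 hs hv
      (fun h => h1 ⟨hj3, h⟩) (fun h => h2 ⟨by omega, h⟩)
  -- Only the layer `0` can have `k s = 0`; its path is good thanks to the counts of layer `1`,
  -- which lies below the threshold for large `n`.
  by_cases hs0 : k s = 0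
  · have hs : s = 0 := by
      by_contra hne
      obtain ⟨t, rfl⟩ := Nat.exists_eq_succ_of_ne_zero hne
      have := hk t
      rw [Nat.succ_eq_add_one] at hs0
      omega
    have hk1' : k 1 ≠ 0 := by
      have := hk 0
      rw [zero_add] at this
      omega
    have hk1p : (0 : ℝ) < k 1 := by positivity
    obtain ⟨-, hC, ht⟩ := counts 1 hk1' hk1
    refine ⟨by omega, ?_⟩
    rw [hs0]
    subst hs
    refine goodPath_zero_of_totalCount hl1 hc hc1 (by positivity) hC ?_
    calc (n : ℝ) ^ (1 / 8 : ℝ) * (11 * √(n : ℝ) * Real.log n / k 1) * l 0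
        = ((n : ℝ) ^ (1 / 8 : ℝ) * (11 * √(n : ℝ) * Real.log n) * l 0) / k 1 := by ring
      _ ≤ (c₀ * (9 / 12800 / 128) * n) / k 1 := by gcongr
      _ = c₀ * (9 / 12800 / 128 * n / k 1) := by ring
      _ ≤ _ := by gcongr
  · have hkp : (0 : ℝ) < k s := by positivity
    obtain ⟨hsn, hC, ht⟩ := counts s hs0 (sqrt_threshold (by linarith) hks)
    refine ⟨hsn, goodPath_of_totalCount hl1 hc hc1 (by positivity) hC ?_⟩
    calc (n : ℝ) ^ (1 / 8 : ℝ) * (11 * √(n : ℝ) * Real.log n / k s)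
        = ((n : ℝ) ^ (1 / 8 : ℝ) * (11 * √(n : ℝ) * Real.log n) * 1) / k s := by ring
      _ ≤ (c₀ * (9 / 12800 / 128) * n) / k s := by gcongr
      _ = c₀ * (9 / 12800 / 128 * n / k s) := by ring
      _ ≤ _ := by gcongr

end main

theorem proposition9p2 :
    ∃ d₂ : ℝ, 0 < d₂ ∧
      ∀ (A B : Type*) [Group A] [Fintype A] [Group B] [Fintype B]
        (Γ : ℕ → Type*) [∀ s, Group (Γ s)] [∀ s, Fintype (Γ s)]
        (a : ∀ s, A →* Γ s) (b : ∀ s, B →* Γ s) (k : ℕ → ℕ) (σ c₀ m₀ : ℝ)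
        (Ω : Type*) [MeasurableSpace Ω] (P : Measure Ω) [IsProbabilityMeasure P]
        (W : ℕ → Ω → Delta a b k),
        (∀ s, Function.Injective (a s)) →
        (∀ s, Function.Injective (b s)) →
        (∀ s, Subgroup.closure (lampGens (a s) (b s)) = ⊤) →
        0 < σ → 0 < c₀ → c₀ < 1 →
        LinearSpeed a b σ (fun s => c₀ * groupDiam (lampGens (a s) (b s))) →
        1 < m₀ →
        (∀ s, 2 * k s < k (s + 1)) →
        (∀ s, m₀ * groupDiam (lampGens (a s) (b s)) ≤
          groupDiam (lampGens (a (s + 1)) (b (s + 1)))) →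
        IsRandomWalk (switchWalkSwitch a b k) P W →
        ∀ᵐ ω ∂P, ∀ᶠ n : ℕ in atTop, ∀ s : ℕ,
          (k s : ℝ) ≤ d₂ * √(n : ℝ) / √(Real.log (Real.log n)) →
          σ * c₀ / 16 *
              ∑' x : ℤ, min (excursionCount (fun t => cursor (W t ω)) (k s) x n : ℝ)
                (c₀ * groupDiam (lampGens (a s) (b s)))
            ≤ (layerLength (a s) (b s) (k s) ((W n ω : ∀ s, Lamplighter (Γ s)) s) : ℝ) := by
  refine ⟨√scaleConst, Real.sqrt_pos.mpr (by unfold scaleConst; norm_num), ?_⟩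
  intro A B _ _ _ _ Γ _ _ a b k σ c₀ m₀ Ω _ P _ W ha _ hS hσ hc hc1 hspeed hm hk hl hW
  set l : ℕ → ℕ := fun s => groupDiam (lampGens (a s) (b s)) with hldef
  -- If all diameters vanish, every truncated count is `0` and so is the left-hand side.
  by_cases hex : ∃ s, l s ≠ 0
  swap
  · push Not at hex
    refine ae_of_all _ fun ω => Eventually.of_forall fun n s _ => ?_
    have h0 : groupDiam (lampGens (a s) (b s)) = 0 := hex s
    simp [h0]
  obtain ⟨s₀, hs₀⟩ := hex
  have hl0 : (1 : ℝ) ≤ l s₀ := by exact_mod_cast Nat.one_le_iff_ne_zero.mpr hs₀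
  -- If `A` were trivial, each lamp group would be the image of `B` and have diameter at most `1`,
  -- against `l (s₀ + 1) ≥ m₀ * l s₀ > 1`.
  have hA : 2 ≤ Fintype.card A := by
    by_contra hlt
    have h1 : l (s₀ + 1) ≤ 1 := groupDiam_le_one (a _) (b _) (hS _) (by omega)
    have h2 : (l (s₀ + 1) : ℝ) ≤ 1 := by exact_mod_cast h1
    have h3 : m₀ * l s₀ ≤ l (s₀ + 1) := hl s₀
    nlinarith
  -- The diameters grow geometrically, so `t = 1` is admissible in some layer, and one step of `η`
  -- has length at most `3`.
  have hσ3 : σ ≤ 3 := by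
    have hgrow : ∀ i : ℕ, m₀ ^ i ≤ l (s₀ + i) := by
      intro i
      induction i with
      | zero => simpa using hl0
      | succ i ih =>
        calc m₀ ^ (i + 1) = m₀ * m₀ ^ i := pow_succ' _ _
          _ ≤ m₀ * l (s₀ + i) := by gcongr
          _ ≤ _ := hl (s₀ + i)
    obtain ⟨i, hi⟩ := pow_unbounded_of_one_lt (1 / c₀) hm
    have h1 : 1 ≤ c₀ * l (s₀ + i) := by
      have := hi.le.trans (hgrow i)
      rw [div_le_iff₀ hc] at this
      linarith
    have h2 := hspeed (s₀ + i) 1 (by simpa using h1)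
    have h3 := lampSpeed_one_le (a (s₀ + i)) (b (s₀ + i)) (hS _)
    simp only [Nat.cast_one, mul_one] at h2
    linarith
  have E3 : ∀ᵐ ω ∂P, ∀ᶠ n : ℕ in atTop, ω ∉ ⋃ s ∈ Finset.range (n + 1),
      {ω | GoodPath (k s) (l s) n (c₀ * l s) (walkSteps W n ω) ∧
      (∑ x ∈ switchSites (k s) 0 (walkSteps W n ω),
        (wordLength (lampGens (a s) (b s)) (((W n ω).1 s).lamp x) : ℝ)) <
      σ / 16 * ∑ x ∈ switchSites (k s) 0 (walkSteps W n ω),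
        min (siteCount (k s) 0 (walkSteps W n ω) x : ℝ) (c₀ * l s)} := by
    refine ae_eventually_notMem_of_le (fun n => ?_)
      (summable_mul_exp_neg_rpow (show 0 < σ / 768 by positivity))
    refine (measure_biUnion_finset_le _ _).trans ?_
    calc _ ≤ ∑ s ∈ Finset.range (n + 1),
          ENNReal.ofReal (Real.exp (-(σ / 768 * (n : ℝ) ^ (1 / 8 : ℝ)))) :=
          Finset.sum_le_sum fun s _ => measure_sum_wordLength_lt_le hW s (ha s) hA (hS s) hσ.le hσ3
            (by positivity) (hspeed s) n
      _ = _ := by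
          rw [Finset.sum_const, Finset.card_range, nsmul_eq_mul,
            ENNReal.ofReal_mul (by positivity)]
          congr 1
          rw [← Nat.cast_add_one, ENNReal.ofReal_natCast]
  filter_upwards [E3, ae_eventually_goodPath hk hc hc1 l hW] with ω h3 hgood
  filter_upwards [h3, hgood] with n h3 hgood s hks
  by_cases hls : l s = 0
  · have h0 : groupDiam (lampGens (a s) (b s)) = 0 := hls
    simp [h0]
  obtain ⟨hsn, hg⟩ := hgood s hls hks
  have hnot : ¬ ((∑ x ∈ switchSites (k s) 0 (walkSteps W n ω),
        (wordLength (lampGens (a s) (b s)) (((W n ω).1 s).lamp x) : ℝ)) <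
      σ / 16 * ∑ x ∈ switchSites (k s) 0 (walkSteps W n ω),
        min (siteCount (k s) 0 (walkSteps W n ω) x : ℝ) (c₀ * l s)) := fun hlt =>
    h3 (Set.mem_biUnion (Finset.mem_coe.mpr (Finset.mem_range.mpr (by omega))) ⟨hg, hlt⟩)
  have hlayer := sum_wordLength_lamp_le (a s) (b s) (k s) (hS s)
    (switchSites (k s) 0 (walkSteps W n ω)) (mem_closure_layer a b k (W n ω) s)
  have hlayer' : (∑ x ∈ switchSites (k s) 0 (walkSteps W n ω),
      (wordLength (lampGens (a s) (b s)) (((W n ω).1 s).lamp x) : ℝ)) ≤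
      layerLength (a s) (b s) (k s) ((W n ω).1 s) := by exact_mod_cast hlayer
  have hT : 0 ≤ c₀ * (l s : ℝ) := by positivity
  have htsum := tsum_min_excursionCount_le hW.1 ω n (k s) hT
  have hM : 0 ≤ ∑ x ∈ switchSites (k s) 0 (walkSteps W n ω),
      min (siteCount (k s) 0 (walkSteps W n ω) x : ℝ) (c₀ * l s) :=
    Finset.sum_nonneg fun x _ => by positivity
  refine le_trans ?_ ((not_lt.mp hnot).trans hlayer')
  calc _ ≤ σ * c₀ / 16 * ∑ x ∈ switchSites (k s) 0 (walkSteps W n ω),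
      min (siteCount (k s) 0 (walkSteps W n ω) x : ℝ) (c₀ * l s) := by gcongr
    _ ≤ _ := by
      -- The bound holds with `σ / 16`; the factor `c₀ < 1` is given away.
      refine mul_le_mul_of_nonneg_right ?_ hM
      nlinarith
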